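/- Conventions. Let $K$ be a field. A $K$-variety is a skeletally small additive $K$-linear category in which idempotents split; it is Hom-finite if all its Hom spaces are finite dimensional. For a $K$-linear category $\mathcal C$, $\mathrm{Mod}(\mathcal C)$ is the category of $K$-linear functors $\mathcal C\to\mathrm{Mod}(K)$, and $\mathrm{mod}(\mathcal C)$ is its full subcategory of those $M$ admitting an exact sequence $P_1\to P_0\to M\to 0$ with $P_0,P_1$ finitely generated projective. Let $\mathbb D_{\mathcal C}:\mathrm{Mod}(\mathcal C)\to \mathrm{Mod}(\mathcal C^{op})$ be the contravariant functor $\mathbb D_{\mathcal C}(M)(C)=\mathrm{Hom}_K(M(C),K)$, and similarly $\mathbb D_{\mathcal C^{op}}:\mathrm{Mod}(\mathcal C^{op})\to\mathrm{Mod}(\mathcal C)$. A Hom-finite $K$-variety $\mathcal C$ is dualizing if $\mathbb D_{\mathcal C}$ induces a duality $\mathrm{mod}(\mathcal C)\to\mathrm{mod}(\mathcal C^{op})$. Let $M\in \mathrm{Mod}(\mathcal C\otimes_K\mathcal C^{op})$, i.e. a functor $M(U,T)$, $K$-linear covariant in $U\in\mathcal C$ and $K$-linear contravariant in $T\in\mathcal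 C$. The triangular matrix category $\left[\begin{smallmatrix}\mathcal C&0\\M&\mathcal C\end{smallmatrix}\right]$ has as objects the pairs $(T,U)$ of objects of $\mathcal C$; a morphism $(T,U)\to(T',U')$ is a matrix $\left[\begin{smallmatrix}t&0\\m&u\end{smallmatrix}\right]$ with $t\in\mathcal C(T,T')$, $u\in\mathcal C(U,U')$, $m\in M(U',T)$, and composition is matrix multiplication. Put $M_T=M(-,T)\in\mathrm{Mod}(\mathcal C)$ and $M_U=M(U,-)\in\mathrm{Mod}(\mathcal C^{op})$. Let $\mathbb F:\mathrm{Mod}(\mathcal C)\to\mathrm{Mod}(\mathcal C)$ be the left adjoint of $\mathbb G$, $\mathbb G(B)(T)=\mathrm{Hom}_{\mathrm{Mod}(\mathcal C)}(M_T,B)$, and let $\overline{\mathbb F}:\mathrm{Mod}(\mathcal C^{op})\to\mathrm{Mod}(\mathcal C^{op})$ be the left adjoint of $\overline{\mathbb G}$, $\overline{\mathbb G}(B)(U)=\mathrm{Hom}_{\mathrm{Mod}(\mathcal C^{op})}(M_U,B)$ (these left adjoints exist in the situation below). Write $\widehat{\mathrm{Hom}}(U,T)=\mathrm{Hom}_{\mathcal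 C}(T,U)$ and, if $\mathcal C$ is abelian, $\widehat{\mathrm{Ext}^n}(U,T)=\mathrm{Ext}^n_{\mathcal C}(T,U)$. $L^n$ denotes the $n$-th left derived functor. Proposition. Let $\mathcal C$ be a dualizing $K$-variety. (a) The triangular matrix category $\left[\begin{smallmatrix}\mathcal C&0\\ \widehat{\mathrm{Hom}}&\mathcal C\end{smallmatrix}\right]$ is a dualizing $K$-variety. (b) Suppose that $\mathcal C$ is abelian with enough projectives, let $n\ge 1$, and suppose that $\mathrm{Ext}^n_{\mathcal C}(-,C)\in\mathrm{mod}(\mathcal C^{op})$ and $\mathrm{Ext}^n_{\mathcal C}(C,-)\in\mathrm{mod}(\mathcal C)$ for every $C\in\mathcal C$. Then $\left[\begin{smallmatrix}\mathcal C&0\\ \widehat{\mathrm{Ext}^n}&\mathcal C\end{smallmatrix}\right]$ is a dualizing $K$-variety. Moreover, with $\mathbb F,\overline{\mathbb F}$ formed for $M=\widehat{\mathrm{Ext}^n}$: - for every $B\in\mathrm{Mod}(\mathcal C^{op})$ such that $\mathbb D_{\mathcal C^{op}}(B)$ lies in $\mathrm{mod}(\mathcal C)$ and is a right exact functor on $\mathcal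 C$, $\mathbb D_{\mathcal C^{op}}\overline{\mathbb F}(B)\simeq L^n(\mathbb D_{\mathcal C^{op}}(B))$ as functors on $\mathcal C$; - $\mathcal C$ has enough injectives, and for every $A\in\mathrm{Mod}(\mathcal C)$ such that $\mathbb D_{\mathcal C}(A)$ lies in $\mathrm{mod}(\mathcal C^{op})$ and is a right exact functor on $\mathcal C^{op}$, $\mathbb D_{\mathcal C}\mathbb F(A)\simeq L^n(\mathbb D_{\mathcal C}(A))$ as functors on $\mathcal C^{op}$. (c) Suppose that $\mathcal C$ is abelian with enough projectives. Then all the conclusions of (b) hold for $n=1$, without the hypothesis that the $\mathrm{Ext}^1$ functors are finitely presented. -/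

import Mathlib

open CategoryTheory CategoryTheory.Limits Opposite

universe v u u₁ u₂

namespace TriangularCategory

noncomputable section

/-! ### Modules over a `K`-linear category -/

section Modules

variable (K : Type v) [Field K]

/-- The opposite of a `K`-linear category is `K`-linear. -/
instance oppositeLinear (C : Type u) [Category.{v} C] [Preadditive C] [Linear K C] :
    Linear K Cᵒᵖ where
  homModule X Y := 
    { smul := fun r f => (r • f.unop).op
      one_smul := fun f => Quiver.Hom.unop_inj (one_smul K f.unop)
      mul_smul := fun r s f => Quiver.Hom.unop_inj (mul_smul r s f.unop)
      smul_zero := fun r => Quiver.Hom.unop_inj (smul_zero (A := Y.unop ⟶ X.unop) r)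
      smul_add := fun r f g => Quiver.Hom.unop_inj (smul_add r f.unop g.unop)
      add_smul := fun r s f => Quiver.Hom.unop_inj (add_smul r s f.unop)
      zero_smul := fun f => Quiver.Hom.unop_inj (zero_smul K f.unop) }
  smul_comp _ _ _ r f g := Quiver.Hom.unop_inj (Linear.comp_smul _ _ _ g.unop r f.unop)
  comp_smul _ _ _ f r g := Quiver.Hom.unop_inj (Linear.smul_comp _ _ _ r g.unop f.unop)

variable (C : Type u) [Category.{v} C] [Preadditive C] [Linear K C]

/-- The property of being a `K`-linear (in particular additive) functor `C ⥤ Mod K`. -/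
def linearProp : ObjectProperty (C ⥤ ModuleCat.{v} K) :=
  fun F => F.Additive ∧ F.Linear K

/-- `Mod(C)`: the category of (left) `C`-modules, i.e. of `K`-linear functors from `C` to
`K`-vector spaces, with natural transformations as morphisms. -/
abbrev LMod : Type _ := (linearProp K C).FullSubcategory

variable {C}

instance (M : LMod K C) : M.obj.Additive := M.property.1

instance (M : LMod K C) : M.obj.Linear K := M.property.2

variable {K}

/-- `M` is finitely generated: finitely many elements `xᵢ ∈ M(Xᵢ)` generate it. -/
def IsFG (M : LMod K C) : Prop :=
  ∃ (n : ℕ) (X : Fin n → C) (x : ∀ i, M.obj.obj (X i)),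
    ∀ (Y : C) (y : M.obj.obj Y), ∃ f : ∀ i, X i ⟶ Y, y = ∑ i, (M.obj.map (f i)).hom (x i)

/-- `M` is finitely presented: there is an exact sequence `P₁ ⟶ P₀ ⟶ M ⟶ 0` in `Mod(C)` with
`P₁` and `P₀` finitely generated projective. -/
def IsFP (M : LMod K C) : Prop :=
  ∃ (P₁ P₀ : LMod K C) (f : P₁ ⟶ P₀) (g : P₀ ⟶ M),
    IsFG P₁ ∧ Projective P₁ ∧ IsFG P₀ ∧ Projective P₀ ∧
    (∀ X : C, Function.Exact (f.hom.app X).hom (g.hom.app X).hom) ∧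
    ∀ X : C, Function.Surjective (g.hom.app X).hom

variable (K C)

/-- `mod(C)`, as a property of objects of `Mod(C)`. -/
def fpProp : ObjectProperty (LMod K C) := fun M => IsFP M

/-- The contravariant functor `Hom_K(-, K)` on `K`-vector spaces. -/
def vectDual : (ModuleCat.{v} K)ᵒᵖ ⥤ ModuleCat.{v} K where
  obj V := ModuleCat.of K (Module.Dual K V.unop)
  map f := ModuleCat.ofHom (Module.Dual.transpose (R := K) f.unop.hom)

/-- The contravariant functor `D_C : Mod(C) ⥤ Mod(Cᵒᵖ)`, `D(M)(X) = Hom_K(M(X), K)`. -/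
def dual : (LMod K C)ᵒᵖ ⥤ LMod K Cᵒᵖ where
  obj M := 
    { obj := M.unop.obj.op ⋙ vectDual K
      property := by
        refine ⟨⟨fun {X Y f g} => ?_⟩, ⟨fun {X Y} f r => ?_⟩⟩
        · ext (ξ : Module.Dual K _)
          refine LinearMap.ext fun z => ?_
          have h := congrArg (fun t => ξ (t.hom z)) (M.unop.obj.map_add (f := f.unop) (g := g.unop))
          exact h.trans (map_add ξ _ _)
        · ext (ξ : Module.Dual K _)
          refine LinearMap.ext fun z => ?_
          have h := congrArg (fun t => ξ (t.hom z)) (M.unop.obj.map_smul r f.unop)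
          exact h.trans (map_smul ξ _ _) }
  map φ := ObjectProperty.homMk
    { app := fun X => (vectDual K).map (φ.unop.hom.app X.unop).op
      naturality := fun X Y f => by
        ext (ξ : Module.Dual K _)
        refine LinearMap.ext fun z => ?_
        exact congrArg (fun t => ξ (t.hom z)) (φ.unop.hom.naturality f.unop).symm }

/-- The contravariant functor `D_{Cᵒᵖ} : Mod(Cᵒᵖ) ⥤ Mod(C)`, `D(M)(X) = Hom_K(M(X), K)`. -/
def dualOp : (LMod K Cᵒᵖ)ᵒᵖ ⥤ LMod K C where
  obj M :=
    { obj := M.unop.obj.rightOp ⋙ vectDual K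
      property := by
        refine ⟨⟨fun {X Y f g} => ?_⟩, ⟨fun {X Y} f r => ?_⟩⟩
        · ext (ξ : Module.Dual K _)
          refine LinearMap.ext fun z => ?_
          have h := congrArg (fun t => ξ (t.hom z)) (M.unop.obj.map_add (f := f.op) (g := g.op))
          exact h.trans (map_add ξ _ _)
        · ext (ξ : Module.Dual K _)
          refine LinearMap.ext fun z => ?_
          have h := congrArg (fun t => ξ (t.hom z)) (M.unop.obj.map_smul r f.op)
          exact h.trans (map_smul ξ _ _) }
  map φ := ObjectProperty.homMk
    { app := fun X => (vectDual K).map (φ.unop.hom.app (op X)).op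
      naturality := fun X Y f => by
        ext (ξ : Module.Dual K _)
        refine LinearMap.ext fun z => ?_
        exact congrArg (fun t => ξ (t.hom z)) (φ.unop.hom.naturality f.op).symm }

variable {K C} in
/-- If `D_C` maps `mod(C)` into `mod(Cᵒᵖ)`, this is the induced contravariant functor
`mod(C) ⥤ mod(Cᵒᵖ)`. -/
def dualRestrict (h : ∀ M : LMod K C, IsFP M → IsFP ((dual K C).obj (op M))) :
    (fpProp K C).FullSubcategoryᵒᵖ ⥤ (fpProp K Cᵒᵖ).FullSubcategory :=
  (fpProp K Cᵒᵖ).lift ((fpProp K C).ι.op ⋙ dual K C) (fun M => h M.unop.obj M.unop.property)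

/-- A `K`-variety: a skeletally small additive `K`-linear category with split idempotents. -/
structure IsVariety : Prop where
  essentiallySmall : EssentiallySmall.{v} C
  hasFiniteBiproducts : HasFiniteBiproducts C
  isIdempotentComplete : IsIdempotentComplete C

/-- A dualizing `K`-variety: a `Hom`-finite `K`-variety `C` such that `D_C` induces a duality
`mod(C) ⥤ mod(Cᵒᵖ)`. -/
structure IsDualizing : Prop extends IsVariety C where
  homFinite : ∀ X Y : C, Module.Finite K (X ⟶ Y)
  duality : ∃ h : ∀ M : LMod K C, IsFP M → IsFP ((dual K C).obj (op M)),
    (dualRestrict h).IsEquivalence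

end Modules

/-! ### Bimodules, the triangular matrix category, and the functors `𝔾` -/

/-- An object of `Mod(U ⊗_K Tᵒᵖ)`, given as a functor of two variables, contravariant in
`T` and covariant in `U`, that is `K`-linear in each variable. The value `M(U, T)` is
`(bifunctor.obj (op T)).obj U`. -/
structure Bimodule (K : Type v) [Field K]
    (T : Type u₁) [Category.{v} T] [Preadditive T] [Linear K T]
    (U : Type u₂) [Category.{v} U] [Preadditive U] [Linear K U] where
  bifunctor : Tᵒᵖ ⥤ U ⥤ ModuleCat.{v} K
  linear_left : ∀ X : Tᵒᵖ, linearProp K U (bifunctor.obj X)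
  linear_right : ∀ Y : U, linearProp K Tᵒᵖ (bifunctor.flip.obj Y)

section Bimodules

variable {K : Type v} [Field K]
  {T : Type u₁} [Category.{v} T] [Preadditive T] [Linear K T]
  {U : Type u₂} [Category.{v} U] [Preadditive U] [Linear K U]

namespace Bimodule

variable (M : Bimodule K T U)

/-- The contravariant functor `X ↦ M_X = M(-, X)` from `T` to `Mod(U)`. -/
def left : Tᵒᵖ ⥤ LMod K U :=
  (linearProp K U).lift M.bifunctor M.linear_left

lemma left_map_add {X X' : T} (f g : X ⟶ X') :
    M.left.map (f + g).op = M.left.map f.op + M.left.map g.op := by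
  ext Y z
  exact congrArg (fun φ => φ.hom z) ((M.linear_right Y).1.map_add (f := f.op) (g := g.op))

lemma left_map_smul {X X' : T} (f : X ⟶ X') (r : K) :
    M.left.map (r • f).op = r • M.left.map f.op := by
  ext Y z
  exact congrArg (fun φ => φ.hom z) ((M.linear_right Y).2.map_smul f.op r)

/-- The functor `Y ↦ M_Y = M(Y, -)` from `U` to `Mod(Tᵒᵖ)`. -/
def right : U ⥤ LMod K Tᵒᵖ :=
  (linearProp K Tᵒᵖ).lift M.bifunctor.flip M.linear_right

/-- The bimodule `M̄` with `M̄(T, U) = M(U, T)`, an object of `Mod(Tᵒᵖ ⊗_K U)`. -/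
def bar : Bimodule K Uᵒᵖ Tᵒᵖ where
  bifunctor := unopUnop U ⋙ M.bifunctor.flip
  linear_left Y := M.linear_right Y.unop.unop
  linear_right X := by
    obtain ⟨h₁, h₂⟩ := M.linear_left X
    exact ⟨⟨fun {_ _ f g} => h₁.map_add (f := f.unop.unop) (g := g.unop.unop)⟩,
      ⟨fun f r => h₂.map_smul f.unop.unop r⟩⟩

instance (X : Tᵒᵖ) : (M.bifunctor.obj X).Additive := (M.linear_left X).1

instance (X : Tᵒᵖ) : (M.bifunctor.obj X).Linear K := (M.linear_left X).2

/-- The left action `u • m = M(u ⊗ 1)(m)`, for `u : Y ⟶ Y'` and `m ∈ M(Y, X)`. -/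
def lact {X : T} {Y Y' : U} (u : Y ⟶ Y') (m : (M.bifunctor.obj (op X)).obj Y) :
    (M.bifunctor.obj (op X)).obj Y' :=
  ((M.bifunctor.obj (op X)).map u).hom m

/-- The right action `m • t = M(1 ⊗ t)(m)`, for `t : X ⟶ X'` and `m ∈ M(Y, X')`. -/
def ract {X X' : T} {Y : U} (m : (M.bifunctor.obj (op X')).obj Y) (t : X ⟶ X') :
    (M.bifunctor.obj (op X)).obj Y :=
  ((M.bifunctor.map t.op).app Y).hom m

section

variable {X X' X'' : T} {Y Y' Y'' : U}

lemma lact_id (m : (M.bifunctor.obj (op X)).obj Y) : M.lact (𝟙 Y) m = m := by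
  simp [lact]

lemma lact_comp (u : Y ⟶ Y') (u' : Y' ⟶ Y'') (m : (M.bifunctor.obj (op X)).obj Y) :
    M.lact (u ≫ u') m = M.lact u' (M.lact u m) := by
  simp [lact]

lemma lact_add (u : Y ⟶ Y') (m m' : (M.bifunctor.obj (op X)).obj Y) :
    M.lact u (m + m') = M.lact u m + M.lact u m' :=
  map_add _ _ _

lemma lact_smul (u : Y ⟶ Y') (r : K) (m : (M.bifunctor.obj (op X)).obj Y) :
    M.lact u (r • m) = r • M.lact u m :=
  map_smul _ _ _

lemma lact_zero (u : Y ⟶ Y') : M.lact u (0 : (M.bifunctor.obj (op X)).obj Y) = 0 :=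
  map_zero _

lemma add_lact (u u' : Y ⟶ Y') (m : (M.bifunctor.obj (op X)).obj Y) :
    M.lact (u + u') m = M.lact u m + M.lact u' m := by
  simp [lact, Functor.map_add]

lemma smul_lact (r : K) (u : Y ⟶ Y') (m : (M.bifunctor.obj (op X)).obj Y) :
    M.lact (r • u) m = r • M.lact u m := by
  simp [lact, Functor.map_smul]

lemma ract_id (m : (M.bifunctor.obj (op X)).obj Y) : M.ract m (𝟙 X) = m := by
  simp [ract]

lemma ract_comp (m : (M.bifunctor.obj (op X'')).obj Y) (t : X ⟶ X') (t' : X' ⟶ X'') :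
    M.ract m (t ≫ t') = M.ract (M.ract m t') t := by
  simp [ract]

lemma add_ract (m m' : (M.bifunctor.obj (op X')).obj Y) (t : X ⟶ X') :
    M.ract (m + m') t = M.ract m t + M.ract m' t :=
  map_add _ _ _

lemma smul_ract (r : K) (m : (M.bifunctor.obj (op X')).obj Y) (t : X ⟶ X') :
    M.ract (r • m) t = r • M.ract m t :=
  map_smul _ _ _

lemma zero_ract (t : X ⟶ X') : M.ract (0 : (M.bifunctor.obj (op X')).obj Y) t = 0 :=
  map_zero _

lemma ract_add (m : (M.bifunctor.obj (op X')).obj Y) (t t' : X ⟶ X') :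
    M.ract m (t + t') = M.ract m t + M.ract m t' :=
  congrArg (fun φ => φ.hom m) ((M.linear_right Y).1.map_add (f := t.op) (g := t'.op))

lemma ract_smul (r : K) (m : (M.bifunctor.obj (op X')).obj Y) (t : X ⟶ X') :
    M.ract m (r • t) = r • M.ract m t :=
  congrArg (fun φ => φ.hom m) ((M.linear_right Y).2.map_smul t.op r)

lemma lact_ract (u : Y ⟶ Y') (m : (M.bifunctor.obj (op X')).obj Y) (t : X ⟶ X') :
    M.lact u (M.ract m t) = M.ract (M.lact u m) t :=
  (congrArg (fun φ => φ.hom m) ((M.bifunctor.map t.op).naturality u)).symm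

end

end Bimodule

/-- Objects `[[X, 0], [M, Y]]` of the triangular matrix category `Λ = [[T, 0], [M, U]]`. -/
structure TriMat (M : Bimodule K T U) where
  fst : T
  snd : U

namespace TriMat

variable {M : Bimodule K T U}

/-- A morphism of `Λ` from `[[X, 0], [M, Y]]` to `[[X', 0], [M, Y']]` is a matrix
`[[t, 0], [m, u]]` with `t : X ⟶ X'`, `m ∈ M(Y', X)` and `u : Y ⟶ Y'`. -/
@[ext]
structure Hom (A B : TriMat M) where
  t : A.fst ⟶ B.fst
  m : (M.bifunctor.obj (op A.fst)).obj B.snd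
  u : A.snd ⟶ B.snd

/-- Composition is matrix multiplication:
`[[t₂, 0], [m₂, u₂]] ∘ [[t₁, 0], [m₁, u₁]] = [[t₂ t₁, 0], [m₂ • t₁ + u₂ • m₁, u₂ u₁]]`. -/
instance : Category.{v} (TriMat M) where
  Hom := Hom
  id A := ⟨𝟙 _, 0, 𝟙 _⟩
  comp f g := ⟨f.t ≫ g.t, M.ract g.m f.t + M.lact g.u f.m, f.u ≫ g.u⟩
  id_comp f := by
    refine Hom.ext (Category.id_comp _) ?_ (Category.id_comp _)
    change M.ract f.m (𝟙 _) + M.lact f.u 0 = f.m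
    rw [M.ract_id, M.lact_zero, add_zero]
  comp_id f := by
    refine Hom.ext (Category.comp_id _) ?_ (Category.comp_id _)
    change M.ract 0 f.t + M.lact (𝟙 _) f.m = f.m
    rw [M.zero_ract, M.lact_id, zero_add]
  assoc f g h := by
    refine Hom.ext (Category.assoc _ _ _) ?_ (Category.assoc _ _ _)
    change M.ract h.m (f.t ≫ g.t) + M.lact h.u (M.ract g.m f.t + M.lact g.u f.m) =
      M.ract (M.ract h.m g.t + M.lact h.u g.m) f.t + M.lact (g.u ≫ h.u) f.m
    rw [M.ract_comp, M.lact_add, M.add_ract, M.lact_comp, M.lact_ract, add_assoc]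

/-- Morphisms of `Λ` as triples `(t, m, u)`. -/
def homEquiv (A B : TriMat M) :
    (A ⟶ B) ≃
      (A.fst ⟶ B.fst) × ((M.bifunctor.obj (op A.fst)).obj B.snd) × (A.snd ⟶ B.snd) where
  toFun f := (f.t, f.m, f.u)
  invFun p := ⟨p.1, p.2.1, p.2.2⟩

/-- Morphisms of `Λ` are added entrywise. -/
instance : Preadditive (TriMat M) where
  homGroup A B := (homEquiv A B).addCommGroup
  add_comp A B C f f' g := by
    refine Hom.ext (Preadditive.add_comp _ _ _ _ _ _) ?_ (Preadditive.add_comp _ _ _ _ _ _)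
    change M.ract g.m (f.t + f'.t) + M.lact g.u (f.m + f'.m) =
      (M.ract g.m f.t + M.lact g.u f.m) + (M.ract g.m f'.t + M.lact g.u f'.m)
    rw [M.ract_add, M.lact_add, add_add_add_comm]
  comp_add A B C f g g' := by
    refine Hom.ext (Preadditive.comp_add _ _ _ _ _ _) ?_ (Preadditive.comp_add _ _ _ _ _ _)
    change M.ract (g.m + g'.m) f.t + M.lact (g.u + g'.u) f.m =
      (M.ract g.m f.t + M.lact g.u f.m) + (M.ract g'.m f.t + M.lact g'.u f.m)
    rw [M.add_ract, M.add_lact, add_add_add_comm]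

/-- Scalars act entrywise on morphisms of `Λ`. -/
instance : Linear K (TriMat M) where
  homModule A B := (homEquiv A B).module K
  smul_comp A B C r f g := by
    refine Hom.ext (Linear.smul_comp _ _ _ _ _ _) ?_ (Linear.smul_comp _ _ _ _ _ _)
    change M.ract g.m (r • f.t) + M.lact g.u (r • f.m) =
      r • (M.ract g.m f.t + M.lact g.u f.m)
    rw [M.ract_smul, M.lact_smul, smul_add]
  comp_smul A B C f r g := by
    refine Hom.ext (Linear.comp_smul _ _ _ _ _ _) ?_ (Linear.comp_smul _ _ _ _ _ _)
    change M.ract (r • g.m) f.t + M.lact (r • g.u) f.m =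
      r • (M.ract g.m f.t + M.lact g.u f.m)
    rw [M.smul_ract, M.smul_lact, smul_add]

end TriMat

/-! Since `U` is skeletally small, the spaces `Hom_{Mod(U)}(N, B)` are (essentially) in the
universe of `K`, so that they can be regarded as `K`-vector spaces there by means of `Shrink`. -/

instance locallySmallLMod [EssentiallySmall.{v} U] : LocallySmall.{v} (LMod K U) where
  hom_small N B := by
    let e := equivSmallModel.{v} U
    refine small_of_injective
      (β := ∀ X : SmallModel.{v} U, N.obj.obj (e.inverse.obj X) ⟶ B.obj.obj (e.inverse.obj X))
      (f := fun φ X => φ.hom.app (e.inverse.obj X)) ?_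
    intro φ ψ h
    ext1
    ext1
    funext Y
    have h' := congrFun h (e.functor.obj Y)
    dsimp only at h'
    have n₁ := φ.hom.naturality (e.unitIso.hom.app Y)
    have n₂ := ψ.hom.naturality (e.unitIso.hom.app Y)
    dsimp at n₁ n₂
    rw [← cancel_mono (B.obj.map (e.unitIso.hom.app Y))]
    exact n₁.symm.trans ((congrArg _ h').trans n₂)

/-- The linear map `Shrink V → Shrink W` induced by `f : V → W`. -/
def shrinkMap {V : Type u₁} {W : Type u₂} [AddCommGroup V] [Module K V] [Small.{v} V]
    [AddCommGroup W] [Module K W] [Small.{v} W] (f : V →ₗ[K] W) :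
    Shrink.{v} V →ₗ[K] Shrink.{v} W :=
  (Shrink.linearEquiv.{v} K W).symm.toLinearMap ∘ₗ f ∘ₗ (Shrink.linearEquiv.{v} K V).toLinearMap

lemma shrinkMap_apply {V : Type u₁} {W : Type u₂} [AddCommGroup V] [Module K V] [Small.{v} V]
    [AddCommGroup W] [Module K W] [Small.{v} W] (f : V →ₗ[K] W) (x : Shrink.{v} V) :
    shrinkMap f x =
      (Shrink.linearEquiv.{v} K W).symm (f (Shrink.linearEquiv.{v} K V x)) :=
  rfl

lemma linearEquiv_shrinkMap {V : Type u₁} {W : Type u₂} [AddCommGroup V] [Module K V]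
    [Small.{v} V] [AddCommGroup W] [Module K W] [Small.{v} W] (f : V →ₗ[K] W)
    (x : Shrink.{v} V) :
    Shrink.linearEquiv.{v} K W (shrinkMap f x) = f (Shrink.linearEquiv.{v} K V x) :=
  (Shrink.linearEquiv.{v} K W).apply_symm_apply _

variable [EssentiallySmall.{v} U]

/-- The functor `𝔾 : Mod(U) ⥤ Mod(T)` of the bimodule `M`,
`𝔾(B)(X) = Hom_{Mod(U)}(M_X, B)`. -/
def Bimodule.G (M : Bimodule K T U) : LMod K U ⥤ LMod K T where
  obj B :=
    { obj :=
        { obj := fun X => ModuleCat.of K (Shrink.{v} (M.left.obj (op X) ⟶ B))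
          map := fun t => ModuleCat.ofHom (shrinkMap (Linear.leftComp K B (M.left.map t.op)))
          map_id := fun X => by
            refine ModuleCat.hom_ext (LinearMap.ext fun x => ?_)
            apply (Shrink.linearEquiv.{v} K (M.left.obj (op X) ⟶ B)).injective
            refine (linearEquiv_shrinkMap _ _).trans ?_
            change M.left.map (𝟙 X).op ≫ _ = Shrink.linearEquiv.{v} K _ x
            rw [op_id, CategoryTheory.Functor.map_id, Category.id_comp]
          map_comp := fun {X _ Z} f g => by
            refine ModuleCat.hom_ext (LinearMap.ext fun x => ?_)
            apply (Shrink.linearEquiv.{v} K (M.left.obj (op Z) ⟶ B)).injective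
            refine (linearEquiv_shrinkMap _ _).trans ?_
            refine Eq.trans ?_ (linearEquiv_shrinkMap _ _).symm
            refine Eq.trans ?_ (congrArg _ (linearEquiv_shrinkMap _ _).symm)
            change M.left.map (f ≫ g).op ≫ _ = M.left.map g.op ≫ M.left.map f.op ≫ _
            rw [op_comp, CategoryTheory.Functor.map_comp, Category.assoc] }
      property := by
        refine ⟨⟨fun {X Y f g} => ?_⟩, ⟨fun {X Y} f r => ?_⟩⟩
        · refine ModuleCat.hom_ext (LinearMap.ext fun x => ?_)
          apply (Shrink.linearEquiv.{v} K (M.left.obj (op Y) ⟶ B)).injective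
          refine (linearEquiv_shrinkMap _ _).trans ?_
          refine Eq.trans ?_ (map_add (Shrink.linearEquiv.{v} K (M.left.obj (op Y) ⟶ B))
            (shrinkMap (Linear.leftComp K B (M.left.map f.op)) x)
            (shrinkMap (Linear.leftComp K B (M.left.map g.op)) x)).symm
          rw [linearEquiv_shrinkMap, linearEquiv_shrinkMap]
          change M.left.map (f + g).op ≫ _ = M.left.map f.op ≫ _ + M.left.map g.op ≫ _
          rw [M.left_map_add, Preadditive.add_comp]
        · refine ModuleCat.hom_ext (LinearMap.ext fun x => ?_)
          apply (Shrink.linearEquiv.{v} K (M.left.obj (op Y) ⟶ B)).injective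
          refine (linearEquiv_shrinkMap _ _).trans ?_
          refine Eq.trans ?_ (map_smul (Shrink.linearEquiv.{v} K (M.left.obj (op Y) ⟶ B)) r
            (shrinkMap (Linear.leftComp K B (M.left.map f.op)) x)).symm
          rw [linearEquiv_shrinkMap]
          change M.left.map (r • f).op ≫ _ = r • (M.left.map f.op ≫ _)
          rw [M.left_map_smul, Linear.smul_comp] }
  map β := ObjectProperty.homMk
    { app := fun X => ModuleCat.ofHom
        (shrinkMap (Linear.rightComp K (M.left.obj (op X)) β))
      naturality := fun X Y f => by
        refine ModuleCat.hom_ext (LinearMap.ext fun x => ?_)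
        apply (Shrink.linearEquiv.{v} K (M.left.obj (op Y) ⟶ _)).injective
        refine (linearEquiv_shrinkMap _ _).trans ?_
        refine Eq.trans ?_ (linearEquiv_shrinkMap _ _).symm
        refine (congrArg _ (linearEquiv_shrinkMap _ _)).trans ?_
        refine Eq.trans ?_ (congrArg _ (linearEquiv_shrinkMap _ _).symm)
        change (M.left.map f.op ≫ _) ≫ β = M.left.map f.op ≫ _ ≫ β
        rw [Category.assoc] }
  map_id B := by
    refine ObjectProperty.hom_ext _ (NatTrans.ext (funext fun X => ?_))
    refine ModuleCat.hom_ext (LinearMap.ext fun x => ?_)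
    apply (Shrink.linearEquiv.{v} K (M.left.obj (op X) ⟶ B)).injective
    refine (linearEquiv_shrinkMap _ _).trans ?_
    change _ ≫ 𝟙 B = Shrink.linearEquiv.{v} K _ x
    rw [Category.comp_id]
  map_comp {_ _ B} β β' := by
    refine ObjectProperty.hom_ext _ (NatTrans.ext (funext fun X => ?_))
    refine ModuleCat.hom_ext (LinearMap.ext fun x => ?_)
    apply (Shrink.linearEquiv.{v} K (M.left.obj (op X) ⟶ B)).injective
    refine (linearEquiv_shrinkMap _ _).trans ?_
    refine Eq.trans ?_ (linearEquiv_shrinkMap _ _).symm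
    refine Eq.trans ?_ (congrArg _ (linearEquiv_shrinkMap _ _).symm)
    change _ ≫ β ≫ β' = (_ ≫ β) ≫ β'
    rw [Category.assoc]

end Bimodules

/-! ### The bimodules `Hom` and `Extⁿ` -/

section HomExt

variable (K : Type v) [Field K]

/-- The bimodule `Hom`, with value `Hom_C(Y, X)` at `(X, Y)`. -/
def homBimodule (C : Type u) [Category.{v} C] [Preadditive C] [Linear K C] : Bimodule K C C where
  bifunctor := linearCoyoneda K C
  linear_left X := ⟨inferInstance, ⟨fun {_ _} f r => by
    ext g
    exact Linear.comp_smul _ _ _ g r f⟩⟩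
  linear_right Y := ⟨⟨fun {_ _} {f g} => by
    ext h
    exact Preadditive.add_comp _ _ _ f.unop g.unop h⟩, ⟨fun {_ _} f r => by
    ext h
    exact Linear.smul_comp _ _ _ r f.unop h⟩⟩

variable (C : Type u) [Category.{v} C] [Abelian C] [Linear K C]

/-- The bimodule `Extⁿ`, with value `Extⁿ_C(Y, X)` at `(X, Y)`; it is functorial through the
Yoneda product with morphisms. -/
def extBimoduleOfHasExt [HasExt.{v} C] (n : ℕ) : Bimodule K C C where
  bifunctor :=
    { obj := fun X =>
        { obj := fun Y => ModuleCat.of K (Abelian.Ext.{v} X.unop Y n)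
          map := fun g => ModuleCat.ofHom
            ((Abelian.Ext.mk₀ g).postcompOfLinear K X.unop (add_zero n))
          map_id := fun Y => by
            ext (α : Abelian.Ext X.unop Y n)
            exact Abelian.Ext.comp_mk₀_id α
          map_comp := fun {Y _ _} g g' => by
            ext (α : Abelian.Ext X.unop Y n)
            change α.comp (Abelian.Ext.mk₀ (g ≫ g')) (add_zero n) =
              (α.comp (Abelian.Ext.mk₀ g) (add_zero n)).comp (Abelian.Ext.mk₀ g') (add_zero n)
            rw [← Abelian.Ext.mk₀_comp_mk₀]
            exact (Abelian.Ext.comp_assoc _ _ _ _ _ (by lia)).symm }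
      map := fun {X X'} f =>
        { app := fun Y => ModuleCat.ofHom
            ((Abelian.Ext.mk₀ f.unop).precompOfLinear K Y (zero_add n))
          naturality := fun Y Y' g => by
            ext (α : Abelian.Ext X.unop Y n)
            change (Abelian.Ext.mk₀ f.unop).comp
                (α.comp (Abelian.Ext.mk₀ g) (add_zero n)) (zero_add n) =
              ((Abelian.Ext.mk₀ f.unop).comp α (zero_add n)).comp
                (Abelian.Ext.mk₀ g) (add_zero n)
            exact (Abelian.Ext.comp_assoc _ _ _ _ _ (by lia)).symm }
      map_id := fun X => by
        ext Y (α : Abelian.Ext X.unop Y n)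
        exact Abelian.Ext.mk₀_id_comp α
      map_comp := fun {X _ _} f f' => by
        ext Y (α : Abelian.Ext X.unop Y n)
        change (Abelian.Ext.mk₀ (f'.unop ≫ f.unop)).comp α (zero_add n) =
          (Abelian.Ext.mk₀ f'.unop).comp
            ((Abelian.Ext.mk₀ f.unop).comp α (zero_add n)) (zero_add n)
        rw [← Abelian.Ext.mk₀_comp_mk₀]
        exact Abelian.Ext.comp_assoc _ _ _ _ _ (by lia) }
  linear_left X := by
    refine ⟨⟨fun {Y Y' f g} => ?_⟩, ⟨fun {Y Y'} f r => ?_⟩⟩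
    · ext (α : Abelian.Ext X.unop Y n)
      change α.comp (Abelian.Ext.mk₀ (f + g)) (add_zero n) =
        α.comp (Abelian.Ext.mk₀ f) (add_zero n) + α.comp (Abelian.Ext.mk₀ g) (add_zero n)
      rw [Abelian.Ext.mk₀_add, Abelian.Ext.comp_add]
    · ext (α : Abelian.Ext X.unop Y n)
      change α.comp (Abelian.Ext.mk₀ (r • f)) (add_zero n) = r • α.comp (Abelian.Ext.mk₀ f) (add_zero n)
      rw [Abelian.Ext.mk₀_smul, Abelian.Ext.comp_smul]
  linear_right Y := by
    refine ⟨⟨fun {X X' f g} => ?_⟩, ⟨fun {X X'} f r => ?_⟩⟩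
    · ext (α : Abelian.Ext X.unop Y n)
      change (Abelian.Ext.mk₀ (f.unop + g.unop)).comp α (zero_add n) =
        (Abelian.Ext.mk₀ f.unop).comp α (zero_add n) + (Abelian.Ext.mk₀ g.unop).comp α (zero_add n)
      rw [Abelian.Ext.mk₀_add, Abelian.Ext.add_comp]
    · ext (α : Abelian.Ext X.unop Y n)
      change (Abelian.Ext.mk₀ (r • f.unop)).comp α (zero_add n) =
        r • (Abelian.Ext.mk₀ f.unop).comp α (zero_add n)
      rw [Abelian.Ext.mk₀_smul, Abelian.Ext.smul_comp]

/-- The bimodule `Extⁿ` of an abelian `K`-category with enough projectives. -/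
def extBimodule [EnoughProjectives C] (n : ℕ) : Bimodule K C C :=
  haveI : HasExt.{v} C := hasExt_of_enoughProjectives.{v} C
  extBimoduleOfHasExt K C n

end HomExt

end

end TriangularCategory

open TriangularCategory

/-!
Everything is reduced to presentations by elements. Over an additive `C`, a module `M` is finitely
presented exactly if there are `x ∈ M(X₀)` and `f : X₀ ⟶ X₁` such that `x` generates `M` and the
relations of `x` are the multiples of `f` (`IsPresentation`, `isFP_iff`). A `Hom`-finite variety is
dualizing exactly if vector space duality preserves finitely presented modules in both directions
(`IsDualizing.dualsPreserveFP`, `IsDualizing.of_dualsPreserveFP`), since on modules with finite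
dimensional values the evaluation morphism to the double dual is invertible.

*The triangular matrix category.* A module over `Λ = [[T, 0], [M, U]]` is finitely presented as soon
as its restrictions along `T ⥤ Λ` and `U ⥤ Λ` are, and conversely if the representable `Λ`-modules
have finitely presented restrictions; the latter are representable, or extensions of representable
modules by some `M(-, X)` or `M(Y, -)`. As duality commutes with restriction, `Λ` is dualizing once
`M` is finitely presented in each variable (`IsGluing.dualsPreserveFP`, `isDualizing_triMat`). The
restrictions of the bimodule `Hom` to either variable are representable.

*Finite presentation of `Extⁿ`.* Let `n = k + 1`, let `P` be a projective resolution of `X` and `Ω`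
the cokernel of `P_{k+2} ⟶ P_{k+1}`. Then `Extⁿ(X, -)` is the cokernel of `C(P_k, -) ⟶ C(Ω, -)`
(`SyzygyData.isPresentation`). If `C` is dualizing it has enough injectives: for `P` projective the
functor `D C(P, -)` is represented by an injective object (`exists_nakayama`,
`enoughInjectives_of_dualsPreserveFP`). Hence `Extⁿ(-, Y)` is presented in the same way by an
injective resolution of `Y` (`isPresentation_coextClass`).

*The derived functors.* The left adjoint of `𝔾` is the tensor product `A ↦ A ⊗ M`, constructed as a
coend (`tensorAdjunction`). If `M(Y, -)` is presented by `f : X₀ ⟶ X₁`, then the dual of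
`(A ⊗ M)(Y)` is the kernel of `D A(f) : D A(X₀) ⟶ D A(X₁)` (`mem_range_dualTensorMap`). For
`M = Extⁿ` this is the kernel of `G(Ω) ⟶ G(P_k)` with `G = D A`, where `P` is a projective resolution
of `Y` in the opposite category and `Ω` its syzygy; when `G` is right exact, this kernel is the
homology of `G(P)` in degree `k + 1`, i.e. `L^{k+1} G` (`nonempty_iso_leftDerived`). The bimodule
`M̄` is treated in the same way with projective resolutions in `C`.
-/

namespace TriangularCategory

noncomputable section

/-! ### Finitely presented modules in terms of elements -/

section Elements

variable {K : Type v} [Field K] {C : Type u} [Category.{v} C] [Preadditive C] [Linear K C]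

namespace LMod

variable (M : LMod K C) {X Y Z : C}

lemma map_id_apply (x : M.obj.obj X) : (M.obj.map (𝟙 X)).hom x = x := by simp

lemma map_comp_apply (f : X ⟶ Y) (g : Y ⟶ Z) (x : M.obj.obj X) :
    (M.obj.map (f ≫ g)).hom x = (M.obj.map g).hom ((M.obj.map f).hom x) := by simp

lemma map_add_apply (f g : X ⟶ Y) (x : M.obj.obj X) :
    (M.obj.map (f + g)).hom x = (M.obj.map f).hom x + (M.obj.map g).hom x := by
  simp [Functor.map_add]

lemma map_sub_apply (f g : X ⟶ Y) (x : M.obj.obj X) :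
    (M.obj.map (f - g)).hom x = (M.obj.map f).hom x - (M.obj.map g).hom x := by
  simp [Functor.map_sub]

lemma map_smul_apply (r : K) (f : X ⟶ Y) (x : M.obj.obj X) :
    (M.obj.map (r • f)).hom x = r • (M.obj.map f).hom x := by
  simp [Functor.map_smul]

variable {M} {N : LMod K C}

lemma naturality_apply (φ : M ⟶ N) (f : X ⟶ Y) (x : M.obj.obj X) :
    (φ.hom.app Y).hom ((M.obj.map f).hom x) = (N.obj.map f).hom ((φ.hom.app X).hom x) :=
  congrArg (fun t => t.hom x) (φ.hom.naturality f)

/-- A morphism of modules from a family of linear maps commuting with the action. -/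
def mkHom (φ : ∀ X, M.obj.obj X →ₗ[K] N.obj.obj X)
    (h : ∀ ⦃X Y : C⦄ (f : X ⟶ Y) x, φ Y ((M.obj.map f).hom x) = (N.obj.map f).hom (φ X x)) :
    M ⟶ N :=
  ObjectProperty.homMk
    { app := fun X => ModuleCat.ofHom (φ X)
      naturality := fun _ _ f => ModuleCat.hom_ext (LinearMap.ext fun x => h f x) }

lemma hom_ext' {φ ψ : M ⟶ N}
    (h : ∀ X (x : M.obj.obj X), (φ.hom.app X).hom x = (ψ.hom.app X).hom x) : φ = ψ :=
  ObjectProperty.hom_ext _ (NatTrans.ext (funext fun X =>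
    ModuleCat.hom_ext (LinearMap.ext fun x => h X x)))

end LMod

/-- `x` generates the module `M`. -/
def IsGenerator (M : LMod K C) {X : C} (x : M.obj.obj X) : Prop :=
  ∀ (Y : C) (y : M.obj.obj Y), ∃ g : X ⟶ Y, (M.obj.map g).hom x = y

/-- `x ∈ M(X₀)` and `f : X₀ ⟶ X₁` present `M`: by the Yoneda lemma this says that
`C(X₁, -) ⟶ C(X₀, -) ⟶ M ⟶ 0` is exact, where the first map is composition with `f` and the second
one corresponds to `x`. -/
structure IsPresentation (M : LMod K C) {X₀ X₁ : C} (f : X₀ ⟶ X₁) (x : M.obj.obj X₀) : Prop where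
  gen : IsGenerator M x
  rel : ∀ ⦃Y : C⦄ (g : X₀ ⟶ Y), (M.obj.map g).hom x = 0 ↔ ∃ h : X₁ ⟶ Y, g = f ≫ h

variable (K) in
/-- The representable module `C(X, -)`. -/
def representable (X : C) : LMod K C := (homBimodule K C).left.obj (op X)

/-- The Yoneda morphism `C(X, -) ⟶ M` given by an element of `M(X)`. -/
def yonedaHom (M : LMod K C) {X : C} (x : M.obj.obj X) : representable K X ⟶ M :=
  LMod.mkHom
    (fun Y =>
      { toFun := fun g : X ⟶ Y => (M.obj.map g).hom x
        map_add' := fun f g => M.map_add_apply f g x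
        map_smul' := fun r f => M.map_smul_apply r f x })
    (fun _ _ f g => M.map_comp_apply (show X ⟶ _ from g) f x)

open scoped ZeroObject in
lemma isPresentation_representable [HasZeroObject C] (X : C) :
    IsPresentation (representable K X) (0 : X ⟶ 0) (𝟙 X : X ⟶ X) where
  gen Y y := ⟨y, Category.id_comp (show X ⟶ Y from y)⟩
  rel Y g := by
    have h : ((representable K X).obj.map g).hom (𝟙 X : X ⟶ X) = g := Category.id_comp g
    rw [h]
    constructor
    · rintro (h : g = 0)
      exact ⟨0, by simp [h]⟩
    · rintro ⟨h, rfl⟩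
      exact zero_comp

lemma epi_of_surjective {M N : LMod K C} (φ : M ⟶ N)
    (h : ∀ X : C, Function.Surjective (φ.hom.app X).hom) : Epi φ := by
  constructor
  intro L a b hab
  refine LMod.hom_ext' fun X x => ?_
  obtain ⟨y, rfl⟩ := h X x
  exact congrArg (fun t => (t.hom.app X).hom y) hab

/-- Epimorphisms of modules are pointwise surjective, because cokernels are formed pointwise. -/
lemma surjective_of_epi {M N : LMod K C} (φ : M ⟶ N) [Epi φ] (X : C) :
    Function.Surjective (φ.hom.app X).hom := by
  -- the pointwise cokernel of `φ`
  let Q : LMod K C :=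
    { obj :=
        { obj := fun X => ModuleCat.of K (N.obj.obj X ⧸ LinearMap.range (φ.hom.app X).hom)
          map := fun {X Y} f => ModuleCat.ofHom (Submodule.mapQ _ _ (N.obj.map f).hom (by
            rintro _ ⟨x, rfl⟩
            exact ⟨(M.obj.map f).hom x, LMod.naturality_apply φ f x⟩))
          map_id := fun X => by
            refine ModuleCat.hom_ext (Submodule.linearMap_qext _ (LinearMap.ext fun x => ?_))
            exact congrArg (Submodule.Quotient.mk) (N.map_id_apply x)
          map_comp := fun f g => by
            refine ModuleCat.hom_ext (Submodule.linearMap_qext _ (LinearMap.ext fun x => ?_))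
            exact congrArg (Submodule.Quotient.mk) (N.map_comp_apply f g x) }
      property := by
        refine ⟨⟨fun {X Y f g} => ?_⟩, ⟨fun {X Y} f r => ?_⟩⟩
        · refine ModuleCat.hom_ext (Submodule.linearMap_qext _ (LinearMap.ext fun x => ?_))
          exact congrArg (Submodule.Quotient.mk) (N.map_add_apply f g x)
        · refine ModuleCat.hom_ext (Submodule.linearMap_qext _ (LinearMap.ext fun x => ?_))
          exact congrArg (Submodule.Quotient.mk) (N.map_smul_apply r f x) }
  let π : N ⟶ Q := LMod.mkHom (fun X => Submodule.mkQ _) (fun _ _ _ _ => rfl)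
  let z : N ⟶ Q := LMod.mkHom (fun X => 0) (fun _ _ _ _ => (map_zero _).symm)
  have h : π = z := by
    rw [← cancel_epi φ]
    refine LMod.hom_ext' fun X x => ?_
    exact (Submodule.Quotient.mk_eq_zero _).2 ⟨x, rfl⟩
  intro y
  exact (Submodule.Quotient.mk_eq_zero _).1 (congrArg (fun t => (t.hom.app X).hom y) h)

instance (X : C) : Projective (representable K X) where
  factors {N L} f e _ := by
    obtain ⟨y, hy⟩ := surjective_of_epi e X ((f.hom.app X).hom (𝟙 X : X ⟶ X))
    refine ⟨yonedaHom N y, LMod.hom_ext' fun Y (g : X ⟶ Y) => ?_⟩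
    calc (e.hom.app Y).hom ((N.obj.map g).hom y)
        = (L.obj.map g).hom ((f.hom.app X).hom (𝟙 X : X ⟶ X)) := by
          rw [LMod.naturality_apply, hy]
      _ = (f.hom.app Y).hom (𝟙 X ≫ g : X ⟶ Y) := (LMod.naturality_apply f g _).symm
      _ = (f.hom.app Y).hom g := by rw [Category.id_comp]

lemma IsGenerator.isFG {M : LMod K C} {X : C} {x : M.obj.obj X} (h : IsGenerator M x) :
    IsFG M := by
  refine ⟨1, fun _ => X, fun _ => x, fun Y y => ?_⟩
  obtain ⟨g, hg⟩ := h Y y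
  exact ⟨fun _ => g, by simp [hg]⟩

lemma isFG_representable (X : C) : IsFG (representable K X) :=
  IsGenerator.isFG (x := (𝟙 X : X ⟶ X)) fun Y y => ⟨y, Category.id_comp (show X ⟶ Y from y)⟩

lemma IsFG.exists_generator [HasFiniteBiproducts C] {M : LMod K C} (h : IsFG M) :
    ∃ (X : C) (x : M.obj.obj X), IsGenerator M x := by
  obtain ⟨n, X, x, hx⟩ := h
  refine ⟨⨁ X, ∑ i, (M.obj.map (biproduct.ι X i)).hom (x i), fun Y y => ?_⟩
  obtain ⟨f, rfl⟩ := hx Y y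
  refine ⟨biproduct.desc f, ?_⟩
  rw [map_sum]
  refine Finset.sum_congr rfl fun i _ => ?_
  rw [← LMod.map_comp_apply, biproduct.ι_desc]

lemma IsPresentation.isFP {M : LMod K C} {X₀ X₁ : C} {f : X₀ ⟶ X₁} {x : M.obj.obj X₀}
    (h : IsPresentation M f x) : IsFP M := by
  refine ⟨representable K X₁, representable K X₀,
    yonedaHom (representable K X₀) (X := X₁) (show X₀ ⟶ X₁ from f),
    yonedaHom M x, isFG_representable _, inferInstance, isFG_representable _, inferInstance,
    fun Y => ?_, fun Y y => h.gen Y y⟩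
  intro (g : X₀ ⟶ Y)
  refine (h.rel g).trans ⟨?_, ?_⟩
  · rintro ⟨k, rfl⟩
    exact ⟨k, rfl⟩
  · rintro ⟨k, hk⟩
    exact ⟨k, hk.symm⟩

/-- Over an additive category, finitely presented modules are those with a presentation by
representable modules: a finitely generated projective module is a retract of a representable one,
so it has such a presentation, and presentations can be composed. -/
lemma isFP_iff [HasFiniteBiproducts C] {M : LMod K C} :
    IsFP M ↔ ∃ (X₀ X₁ : C) (f : X₀ ⟶ X₁) (x : M.obj.obj X₀), IsPresentation M f x := by
  refine ⟨?_, fun ⟨_, _, _, _, h⟩ => h.isFP⟩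
  have := hasBinaryBiproducts_of_finite_biproducts C
  rintro ⟨P₁, P₀, f, g, h₁, -, h₀, _, hfg, hg⟩
  obtain ⟨X₀, p, hp⟩ := h₀.exists_generator
  obtain ⟨X₁, q, hq⟩ := h₁.exists_generator
  have : Epi (yonedaHom P₀ p) := epi_of_surjective _ fun Y y => hp Y y
  -- a section of the projection onto `P₀` corresponds to an idempotent `e` of `X₀`
  obtain ⟨s, hs⟩ := Projective.factors (𝟙 P₀) (yonedaHom P₀ p)
  obtain ⟨e, he⟩ : ∃ e : X₀ ⟶ X₀, (s.hom.app X₀).hom p = e := ⟨_, rfl⟩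
  have hs' : ∀ {Y : C} (k : X₀ ⟶ Y), (s.hom.app Y).hom ((P₀.obj.map k).hom p) = e ≫ k := by
    intro Y k
    rw [LMod.naturality_apply, he]
    rfl
  have hep : (P₀.obj.map e).hom p = p := by
    have := congrArg (fun t => (t.hom.app X₀).hom p) hs
    rw [← he]
    exact this
  have hee : e ≫ e = e := by rw [← hs' e, hep, he]
  have hk : ∀ {Y : C} (k : X₀ ⟶ Y), (P₀.obj.map k).hom p = 0 ↔ ∃ r : X₀ ⟶ Y, k = (𝟙 _ - e) ≫ r := by
    intro Y k
    constructor
    · intro h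
      have h' : e ≫ k = 0 := by
        rw [← hs' k, h, map_zero]; rfl
      exact ⟨k, by simp [Preadditive.sub_comp, h']⟩
    · rintro ⟨r, rfl⟩
      rw [LMod.map_comp_apply, LMod.map_sub_apply, hep, LMod.map_id_apply, sub_self, map_zero]
  obtain ⟨h, hh⟩ := hp X₁ ((f.hom.app X₁).hom q)
  refine ⟨X₀, X₁ ⊞ X₀, biprod.lift h (𝟙 _ - e), (g.hom.app X₀).hom p, ?_, ?_⟩
  · intro Y y
    obtain ⟨z, rfl⟩ := hg Y y
    obtain ⟨k, rfl⟩ := hp Y z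
    exact ⟨k, (LMod.naturality_apply g k p).symm⟩
  · intro Y k
    rw [← LMod.naturality_apply, hfg Y]
    constructor
    · rintro ⟨w, hw⟩
      obtain ⟨l, rfl⟩ := hq Y w
      rw [LMod.naturality_apply, ← hh, ← LMod.map_comp_apply] at hw
      obtain ⟨r, hr⟩ := (hk (k - h ≫ l)).1 (by rw [LMod.map_sub_apply, hw, sub_self])
      exact ⟨biprod.desc l r, by rw [biprod.lift_desc, ← hr]; abel⟩
    · rintro ⟨m, rfl⟩
      obtain ⟨a, b, rfl⟩ : ∃ a b, m = biprod.desc a b :=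
        ⟨biprod.inl ≫ m, biprod.inr ≫ m, by ext <;> simp⟩
      refine ⟨(P₁.obj.map a).hom q, ?_⟩
      rw [LMod.naturality_apply, ← hh, ← LMod.map_comp_apply, ← sub_eq_zero, ← LMod.map_sub_apply,
        hk]
      exact ⟨-b, by rw [biprod.lift_desc, Preadditive.comp_neg]; abel⟩

end Elements

/-! ### Closure properties of finitely presented modules -/

section Closure

variable {K : Type v} [Field K] {C : Type u} [Category.{v} C] [Preadditive C] [Linear K C]
  {L M N : LMod K C}

lemma IsPresentation.of_bijective {X₀ X₁ : C} {f : X₀ ⟶ X₁} {x : M.obj.obj X₀}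
    (h : IsPresentation M f x) (φ : M ⟶ N) (hφ : ∀ X : C, Function.Bijective (φ.hom.app X).hom) :
    IsPresentation N f ((φ.hom.app X₀).hom x) where
  gen Y y := by
    obtain ⟨z, rfl⟩ := (hφ Y).2 y
    obtain ⟨g, rfl⟩ := h.gen Y z
    exact ⟨g, (LMod.naturality_apply φ g x).symm⟩
  rel Y g := by
    rw [← LMod.naturality_apply, map_eq_zero_iff _ (hφ Y).1, h.rel]

variable [HasFiniteBiproducts C]

lemma IsFP.of_bijective (h : IsFP M) (φ : M ⟶ N)
    (hφ : ∀ X : C, Function.Bijective (φ.hom.app X).hom) : IsFP N := by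
  obtain ⟨_, _, _, _, h⟩ := isFP_iff.1 h
  exact (h.of_bijective φ hφ).isFP

lemma IsFP.isFG (h : IsFP M) : IsFG M := by
  obtain ⟨_, _, _, _, h⟩ := isFP_iff.1 h
  exact h.gen.isFG

lemma isFP_representable (X : C) : IsFP (representable K X) :=
  (isPresentation_representable X).isFP

/-- The quotient of a finitely presented module by a finitely generated one is finitely presented. -/
lemma IsFP.cokernel (f : L ⟶ M) (g : M ⟶ N)
    (hfg : ∀ X : C, Function.Exact (f.hom.app X).hom (g.hom.app X).hom)
    (hg : ∀ X : C, Function.Surjective (g.hom.app X).hom) (hL : IsFG L) (hM : IsFP M) :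
    IsFP N := by
  have := hasBinaryBiproducts_of_finite_biproducts C
  obtain ⟨X₀, X₁, a, x, h⟩ := isFP_iff.1 hM
  obtain ⟨Y, y, hy⟩ := hL.exists_generator
  obtain ⟨b, hb⟩ := h.gen Y ((f.hom.app Y).hom y)
  refine IsPresentation.isFP (X₀ := X₀) (X₁ := X₁ ⊞ Y) (f := biprod.lift a b)
    (x := (g.hom.app X₀).hom x) ⟨fun Z z => ?_, fun Z k => ?_⟩
  · obtain ⟨w, rfl⟩ := hg Z z
    obtain ⟨k, rfl⟩ := h.gen Z w
    exact ⟨k, (LMod.naturality_apply g k x).symm⟩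
  · rw [← LMod.naturality_apply, hfg Z]
    constructor
    · rintro ⟨w, hw⟩
      obtain ⟨l, rfl⟩ := hy Z w
      rw [LMod.naturality_apply, ← hb, ← LMod.map_comp_apply] at hw
      obtain ⟨r, hr⟩ := (h.rel (k - b ≫ l)).1 (by rw [LMod.map_sub_apply, hw, sub_self])
      exact ⟨biprod.desc r l, by rw [biprod.lift_desc, ← hr]; abel⟩
    · rintro ⟨m, rfl⟩
      obtain ⟨c, d, rfl⟩ : ∃ c d, m = biprod.desc c d :=
        ⟨biprod.inl ≫ m, biprod.inr ≫ m, by ext <;> simp⟩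
      refine ⟨(L.obj.map d).hom y, ?_⟩
      rw [LMod.naturality_apply, ← hb, ← LMod.map_comp_apply, biprod.lift_desc,
        LMod.map_add_apply, (h.rel (a ≫ c)).2 ⟨c, rfl⟩, zero_add]

/-- An extension of finitely presented modules is finitely presented (horseshoe lemma). -/
lemma IsFP.extension (i : L ⟶ M) (p : M ⟶ N)
    (hi : ∀ X : C, Function.Injective (i.hom.app X).hom)
    (hip : ∀ X : C, Function.Exact (i.hom.app X).hom (p.hom.app X).hom)
    (hp : ∀ X : C, Function.Surjective (p.hom.app X).hom) (hL : IsFP L) (hN : IsFP N) :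
    IsFP M := by
  have := hasBinaryBiproducts_of_finite_biproducts C
  obtain ⟨X₀, X₁, a, x, hx⟩ := isFP_iff.1 hL
  obtain ⟨Y₀, Y₁, b, y, hy⟩ := isFP_iff.1 hN
  obtain ⟨q, rfl⟩ := hp Y₀ y
  obtain ⟨w, hw⟩ := (hip Y₁ _).1 (show (p.hom.app Y₁).hom ((M.obj.map b).hom q) = 0 by
    rw [LMod.naturality_apply]; exact (hy.rel b).2 ⟨𝟙 _, by simp⟩)
  obtain ⟨c, rfl⟩ := hx.gen Y₁ w
  -- the relation `b` on the generator `q` of the quotient is corrected by `c` in the submodule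
  refine IsPresentation.isFP (X₀ := X₀ ⊞ Y₀) (X₁ := X₁ ⊞ Y₁)
    (f := biprod.desc (a ≫ biprod.inl - c ≫ biprod.inr) (b ≫ biprod.inr))
    (x := (M.obj.map biprod.inl).hom ((i.hom.app X₀).hom x) + (M.obj.map biprod.inr).hom q) ?_
  have key : ∀ {Z : C} (k : X₀ ⟶ Z) (l : Y₀ ⟶ Z), (M.obj.map (biprod.desc k l)).hom
      ((M.obj.map biprod.inl).hom ((i.hom.app X₀).hom x) + (M.obj.map biprod.inr).hom q) =
      (i.hom.app Z).hom ((L.obj.map k).hom x) + (M.obj.map l).hom q := by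
    intro Z k l
    rw [map_add, ← LMod.map_comp_apply, ← LMod.map_comp_apply, biprod.inl_desc, biprod.inr_desc,
      ← LMod.naturality_apply]
  have hc : ∀ {Z : C} (l : Y₁ ⟶ Z), (M.obj.map (b ≫ l)).hom q =
      (i.hom.app Z).hom ((L.obj.map (c ≫ l)).hom x) := by
    intro Z l
    rw [LMod.map_comp_apply, ← hw, ← LMod.naturality_apply, ← LMod.map_comp_apply]
  refine ⟨fun Z z => ?_, fun Z k => ?_⟩
  · obtain ⟨l, hl⟩ := hy.gen Z ((p.hom.app Z).hom z)
    obtain ⟨w, hw'⟩ := (hip Z (z - (M.obj.map l).hom q)).1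
      (by rw [map_sub, LMod.naturality_apply, hl, sub_self])
    obtain ⟨k, rfl⟩ := hx.gen Z w
    exact ⟨biprod.desc k l, by rw [key, hw', sub_add_cancel]⟩
  · obtain ⟨k, l, rfl⟩ : ∃ k' l', k = biprod.desc k' l' :=
      ⟨biprod.inl ≫ k, biprod.inr ≫ k, by ext <;> simp⟩
    rw [key]
    constructor
    · intro h
      have hl : (N.obj.map l).hom ((p.hom.app Y₀).hom q) = 0 := by
        rw [← LMod.naturality_apply, eq_neg_of_add_eq_zero_right h, map_neg,
          (hip Z _).2 ⟨_, rfl⟩, neg_zero]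
      obtain ⟨l, rfl⟩ := (hy.rel l).1 hl
      rw [hc, ← map_add, map_eq_zero_iff _ (hi Z), ← LMod.map_add_apply, hx.rel] at h
      obtain ⟨d, hd⟩ := h
      refine ⟨biprod.desc d l, ?_⟩
      ext
      · simp [← hd]
      · simp
    · rintro ⟨m, hm⟩
      obtain ⟨d, l', rfl⟩ : ∃ d l', m = biprod.desc d l' :=
        ⟨biprod.inl ≫ m, biprod.inr ≫ m, by ext <;> simp⟩
      have hk : k = a ≫ d - c ≫ l' := by
        simpa using congrArg (fun t => biprod.inl ≫ t) hm
      have hl : l = b ≫ l' := by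
        simpa using congrArg (fun t => biprod.inr ≫ t) hm
      rw [hk, hl, hc, ← map_add, ← LMod.map_add_apply, sub_add_cancel, (hx.rel _).2 ⟨d, rfl⟩,
        map_zero]

/-- The kernel of a surjection from a finitely generated module onto a finitely presented one is
finitely generated. -/
lemma IsFP.exists_kernel_generator (p : M ⟶ N)
    (hp : ∀ X : C, Function.Surjective (p.hom.app X).hom) (hM : IsFG M) (hN : IsFP N) :
    ∃ (Z : C) (k : M.obj.obj Z), (p.hom.app Z).hom k = 0 ∧
      ∀ (Y : C) (y : M.obj.obj Y), (p.hom.app Y).hom y = 0 →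
        ∃ g : Z ⟶ Y, (M.obj.map g).hom k = y := by
  have := hasBinaryBiproducts_of_finite_biproducts C
  obtain ⟨X₀, X₁, f, x, h⟩ := isFP_iff.1 hN
  obtain ⟨W, w, hw⟩ := hM.exists_generator
  obtain ⟨a, ha⟩ := h.gen W ((p.hom.app W).hom w)
  obtain ⟨y, rfl⟩ := hp X₀ x
  refine ⟨X₁ ⊞ W, (M.obj.map (f ≫ biprod.inl)).hom y +
    (M.obj.map biprod.inr).hom (w - (M.obj.map a).hom y), ?_, fun Y z hz => ?_⟩
  · rw [map_add, LMod.naturality_apply, LMod.naturality_apply, (h.rel _).2 ⟨_, rfl⟩, map_sub,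
      LMod.naturality_apply, ha, sub_self, map_zero, add_zero]
  · obtain ⟨g, rfl⟩ := hw Y z
    rw [LMod.naturality_apply, ← ha, ← LMod.map_comp_apply] at hz
    obtain ⟨l, hl⟩ := (h.rel _).1 hz
    refine ⟨biprod.desc l g, ?_⟩
    rw [map_add, ← LMod.map_comp_apply, ← LMod.map_comp_apply, Category.assoc, biprod.inl_desc,
      biprod.inr_desc, map_sub, ← hl, ← LMod.map_comp_apply]
    abel

end Closure

/-! ### Dualizing varieties in terms of finitely presented modules -/

section Duality

variable {K : Type v} [Field K] {C : Type u} [Category.{v} C] [Preadditive C] [Linear K C]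

/-- The evaluation morphism from a module to its double dual. -/
def evalHom (M : LMod K C) : M ⟶ (dualOp K C).obj (op ((dual K C).obj (op M))) :=
  LMod.mkHom (fun X => Module.Dual.eval K (M.obj.obj X)) (fun _ _ _ _ => rfl)

/-- The evaluation morphism from a module over the opposite category to its double dual. -/
def evalHomOp (M : LMod K Cᵒᵖ) : M ⟶ (dual K C).obj (op ((dualOp K C).obj (op M))) :=
  LMod.mkHom (fun X => Module.Dual.eval K (M.obj.obj X)) (fun _ _ _ _ => rfl)

lemma dual_eval_bijective (V : Type v) [AddCommGroup V] [Module K V] [Module.Finite K V] :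
    Function.Bijective (Module.Dual.eval K V) :=
  (Module.evalEquiv K V).bijective

instance finite_hom_op [h : ∀ X Y : C, Module.Finite K (X ⟶ Y)] (X Y : Cᵒᵖ) :
    Module.Finite K (X ⟶ Y) := by
  have := h Y.unop X.unop
  let e : (Y.unop ⟶ X.unop) ≃ₗ[K] (X ⟶ Y) :=
    { toFun := fun f => f.op
      invFun := fun f => f.unop
      map_add' := fun _ _ => rfl
      map_smul' := fun _ _ => rfl }
  exact Module.Finite.equiv e

lemma hasFiniteBiproducts_op [HasFiniteBiproducts C] : HasFiniteBiproducts Cᵒᵖ :=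
  have : HasFiniteProducts Cᵒᵖ := inferInstance
  HasFiniteBiproducts.of_hasFiniteProducts

lemma IsFP.finite [HasFiniteBiproducts C] [∀ X Y : C, Module.Finite K (X ⟶ Y)] {M : LMod K C}
    (h : IsFP M) (Y : C) : Module.Finite K (M.obj.obj Y) := by
  obtain ⟨X, _, _, x, hx⟩ := isFP_iff.1 h
  have : Module.Finite K ((representable K X).obj.obj Y) :=
    inferInstanceAs (Module.Finite K (X ⟶ Y))
  exact Module.Finite.of_surjective ((yonedaHom M x).hom.app Y).hom (hx.gen Y)

variable (K C) in
/-- Vector space duality in both directions preserves finitely presented modules. -/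
structure DualsPreserveFP : Prop where
  dual : ∀ M : LMod K C, IsFP M → IsFP ((dual K C).obj (op M))
  dualOp : ∀ M : LMod K Cᵒᵖ, IsFP M → IsFP ((dualOp K C).obj (op M))

/-- In a dualizing variety a finitely presented `Cᵒᵖ`-module is isomorphic to the dual of some
finitely presented `M`, so that its dual is the double dual of `M`, i.e. `M` itself. -/
lemma IsDualizing.dualsPreserveFP (h : IsDualizing K C) : DualsPreserveFP K C := by
  have := h.hasFiniteBiproducts
  have := h.homFinite
  obtain ⟨hd, he⟩ := h.duality
  refine ⟨hd, fun N hN => ?_⟩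
  let e := (dualRestrict hd).objObjPreimageIso ⟨N, hN⟩
  let M := ((dualRestrict hd).objPreimage ⟨N, hN⟩).unop
  have hM := M.property
  have hMf := hM.finite
  let e' : (TriangularCategory.dual K C).obj (op M.obj) ≅ N := (fpProp K Cᵒᵖ).ι.mapIso e
  refine IsFP.of_bijective hM
    (evalHom M.obj ≫ (TriangularCategory.dualOp K C).map e'.inv.op) fun X => ?_
  have h₁ := dual_eval_bijective (K := K) (M.obj.obj.obj X)
  have h₂ : Function.Bijective
      (((TriangularCategory.dualOp K C).map e'.inv.op).hom.app X).hom := by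
    have : IsIso (((TriangularCategory.dualOp K C).map e'.inv.op).hom.app X) :=
      inferInstanceAs (IsIso
        (((linearProp K C).ι ⋙ (evaluation _ _).obj X).map
          ((TriangularCategory.dualOp K C).map e'.inv.op)))
    exact ConcreteCategory.bijective_of_isIso
      (((TriangularCategory.dualOp K C).map e'.inv.op).hom.app X)
  exact h₂.comp h₁

/-- The dual is full on modules with finite dimensional values: transpose and evaluate. -/
lemma exists_dual_eq {M N : LMod K C} (hN : ∀ X : C, Module.Finite K (N.obj.obj X))
    (φ : (dual K C).obj (op N) ⟶ (dual K C).obj (op M)) :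
    ∃ f : M ⟶ N, (dual K C).map f.op = φ := by
  let e : ∀ X, N.obj.obj X ≃ₗ[K] Module.Dual K (Module.Dual K (N.obj.obj X)) :=
    fun X => Module.evalEquiv K _
  have key : ∀ (X : C) (m : M.obj.obj X) (ξ : Module.Dual K (N.obj.obj X)),
      ξ ((e X).symm (Module.Dual.transpose (R := K) (φ.hom.app (op X)).hom
        (Module.Dual.eval K (M.obj.obj X) m))) =
        (show Module.Dual K (M.obj.obj X) from (φ.hom.app (op X)).hom ξ) m := by
    intro X m ξ
    exact Module.apply_evalEquiv_symm_apply ..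
  refine ⟨LMod.mkHom (fun X => (e X).symm.toLinearMap ∘ₗ
    Module.Dual.transpose (R := K) (φ.hom.app (op X)).hom ∘ₗ
      Module.Dual.eval K (M.obj.obj X)) (fun X Y f m => ?_), LMod.hom_ext' fun X ξ => ?_⟩
  · apply (e Y).injective
    refine LinearMap.ext fun ξ => ?_
    refine (key Y _ ξ).trans ?_
    refine Eq.trans ?_ (key X m (ξ ∘ₗ (N.obj.map f).hom)).symm
    exact (congrArg (fun t : Module.Dual K (M.obj.obj X) => t m)
      (LMod.naturality_apply φ f.op ξ)).symm
  · exact LinearMap.ext fun m => key X.unop m ξ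

/-- A `Hom`-finite variety is dualizing as soon as both duals preserve finitely presented modules:
these take finite dimensional values, so that the evaluation morphisms are invertible. -/
lemma IsDualizing.of_dualsPreserveFP (hv : IsVariety C)
    (hf : ∀ X Y : C, Module.Finite K (X ⟶ Y)) (hd : DualsPreserveFP K C) : IsDualizing K C := by
  have := hv.hasFiniteBiproducts
  have := hasFiniteBiproducts_op (C := C)
  refine ⟨hv, hf, hd.dual, ?_⟩
  have : (dualRestrict hd.dual).Faithful := by
    refine ⟨fun {X Y} a b hab => ?_⟩
    apply Quiver.Hom.unop_inj
    refine ObjectProperty.hom_ext _ (LMod.hom_ext' fun Z y => ?_)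
    rw [← sub_eq_zero, ← Module.forall_dual_apply_eq_zero_iff K]
    intro ξ
    rw [map_sub, sub_eq_zero]
    exact congrArg (fun t => (show Module.Dual K (Y.unop.obj.obj.obj Z) from
      (t.hom.hom.app (op Z)).hom ξ) y) hab
  have : (dualRestrict hd.dual).Full := by
    refine ⟨fun {X Y} φ => ?_⟩
    obtain ⟨f, hf⟩ := exists_dual_eq (X.unop.property.finite) φ.hom
    exact ⟨Quiver.Hom.op (ObjectProperty.homMk f), ObjectProperty.hom_ext _ hf⟩
  have : (dualRestrict hd.dual).EssSurj := by
    refine ⟨fun N => ?_⟩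
    have hN := N.property.finite
    let e : N.obj ⟶ (dual K C).obj (op ((dualOp K C).obj (op N.obj))) := evalHomOp N.obj
    have : ∀ X, IsIso (e.hom.app X) := fun X =>
      (ConcreteCategory.isIso_iff_bijective _).2 (dual_eval_bijective (K := K) (N.obj.obj.obj X))
    have : IsIso e.hom := NatIso.isIso_of_isIso_app _
    have : IsIso e := (ObjectProperty.isIso_hom_iff _).1 this
    refine ⟨op ⟨_, hd.dualOp _ N.property⟩, ⟨?_⟩⟩
    let e' := asIso e
    exact ((fpProp K Cᵒᵖ).isoMk e').symm
  exact { }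

end Duality

/-! ### Gluing two categories -/

section Gluing

variable {K : Type v} [Field K] {T U L : Type*} [Category.{v} T] [Preadditive T] [Linear K T]
  [Category.{v} U] [Preadditive U] [Linear K U] [Category.{v} L] [Preadditive L] [Linear K L]

/-- Restriction of modules along a `K`-linear functor. -/
def restrict (i : T ⥤ L) [i.Additive] [i.Linear K] : LMod K L ⥤ LMod K T where
  obj F :=
    { obj := i ⋙ F.obj
      property := ⟨inferInstance, inferInstance⟩ }
  map φ := ObjectProperty.homMk (Functor.whiskerLeft i φ.hom)

instance (i : T ⥤ L) [i.Additive] [i.Linear K] : i.op.Linear K where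
  map_smul f r := Quiver.Hom.unop_inj (i.map_smul r f.unop)

variable (K) in
/-- The category `L` is glued from `T` and `U` along `i₁ : T ⥤ L` and `i₂ : U ⥤ L`: every object
of `L` is a direct summand of a biproduct of an object coming from `T` and one coming from `U`, and
the representable `L`-modules restrict to finitely presented modules over `T` and `U`. -/
structure IsGluing (i₁ : T ⥤ L) [i₁.Additive] [i₁.Linear K] (i₂ : U ⥤ L) [i₂.Additive]
    [i₂.Linear K] : Prop where
  decomposition (l : L) : ∃ (X : T) (Y : U) (p₁ : l ⟶ i₁.obj X) (j₁ : i₁.obj X ⟶ l)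
    (p₂ : l ⟶ i₂.obj Y) (j₂ : i₂.obj Y ⟶ l), p₁ ≫ j₁ + p₂ ≫ j₂ = 𝟙 l
  isFP₁ (l : L) : IsFP ((restrict i₁).obj (representable K l))
  isFP₂ (l : L) : IsFP ((restrict i₂).obj (representable K l))

/-- Restriction preserves finitely presented modules if it does so for the representable ones. -/
lemma IsFP.restrict [HasFiniteBiproducts T] [HasFiniteBiproducts L] (i : T ⥤ L) [i.Additive]
    [i.Linear K] (h : ∀ l : L, IsFP ((restrict i).obj (representable K l))) {F : LMod K L}
    (hF : IsFP F) : IsFP ((TriangularCategory.restrict i).obj F) := by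
  obtain ⟨l₀, l₁, f, x, hx⟩ := isFP_iff.1 hF
  refine IsFP.cokernel
    ((TriangularCategory.restrict i).map
      (yonedaHom (representable K l₀) (X := l₁) (show l₀ ⟶ l₁ from f)))
    ((TriangularCategory.restrict i).map (yonedaHom F x))
    (fun X => ?_) (fun X y => hx.gen _ y) (h l₁).isFG (h l₀)
  intro (g : l₀ ⟶ i.obj X)
  refine (hx.rel g).trans ⟨?_, ?_⟩
  · rintro ⟨k, rfl⟩
    exact ⟨k, rfl⟩
  · rintro ⟨k, hk⟩
    exact ⟨k, hk.symm⟩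

variable {i₁ : T ⥤ L} [i₁.Additive] [i₁.Linear K] {i₂ : U ⥤ L} [i₂.Additive] [i₂.Linear K]
  [HasFiniteBiproducts T] [HasFiniteBiproducts U] [HasFiniteBiproducts L]

/-- Over a glued category, a module is finitely presented as soon as both restrictions are:
generators of the restrictions generate the module, and likewise for the relations. -/
lemma IsGluing.isFP (h : IsGluing K i₁ i₂) {F : LMod K L} (h₁ : IsFP ((restrict i₁).obj F))
    (h₂ : IsFP ((restrict i₂).obj F)) : IsFP F := by
  have := hasBinaryBiproducts_of_finite_biproducts L
  obtain ⟨X₀, x, hx⟩ : ∃ (X₀ : T) (x : F.obj.obj (i₁.obj X₀)), ∀ (X : T)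
      (w : F.obj.obj (i₁.obj X)), ∃ g : X₀ ⟶ X, (F.obj.map (i₁.map g)).hom x = w :=
    h₁.isFG.exists_generator
  obtain ⟨Y₀, y, hy⟩ : ∃ (Y₀ : U) (y : F.obj.obj (i₂.obj Y₀)), ∀ (Y : U)
      (w : F.obj.obj (i₂.obj Y)), ∃ g : Y₀ ⟶ Y, (F.obj.map (i₂.map g)).hom y = w :=
    h₂.isFG.exists_generator
  let z : F.obj.obj (i₁.obj X₀ ⊞ i₂.obj Y₀) :=
    (F.obj.map biprod.inl).hom x + (F.obj.map biprod.inr).hom y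
  have hz : ∀ {l : L} (k : i₁.obj X₀ ⟶ l) (k' : i₂.obj Y₀ ⟶ l),
      (F.obj.map (biprod.desc k k')).hom z = (F.obj.map k).hom x + (F.obj.map k').hom y := by
    intro l k k'
    rw [map_add, ← LMod.map_comp_apply, ← LMod.map_comp_apply, biprod.inl_desc, biprod.inr_desc]
  have hgen : IsGenerator F z := by
    intro l w
    obtain ⟨X, Y, p₁, j₁, p₂, j₂, hl⟩ := h.decomposition l
    obtain ⟨g, hg⟩ := hx X ((F.obj.map p₁).hom w)
    obtain ⟨g', hg'⟩ := hy Y ((F.obj.map p₂).hom w)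
    refine ⟨biprod.desc (i₁.map g ≫ j₁) (i₂.map g' ≫ j₂), ?_⟩
    rw [hz, LMod.map_comp_apply, LMod.map_comp_apply, hg, hg', ← LMod.map_comp_apply,
      ← LMod.map_comp_apply, ← LMod.map_add_apply, hl, LMod.map_id_apply]
  let φ := yonedaHom F z
  obtain ⟨Z₁, (k₁ : _ ⟶ i₁.obj Z₁), hk₁, hk₁'⟩ := IsFP.exists_kernel_generator
    ((restrict i₁).map φ) (fun X w => hgen _ w) (h.isFP₁ _).isFG h₁
  obtain ⟨Z₂, (k₂ : _ ⟶ i₂.obj Z₂), hk₂, hk₂'⟩ := IsFP.exists_kernel_generator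
    ((restrict i₂).map φ) (fun X w => hgen _ w) (h.isFP₂ _).isFG h₂
  replace hk₁ : (F.obj.map k₁).hom z = 0 := hk₁
  replace hk₂ : (F.obj.map k₂).hom z = 0 := hk₂
  refine IsPresentation.isFP (f := biprod.lift k₁ k₂) ⟨hgen, fun l g => ⟨fun hg => ?_, ?_⟩⟩
  · obtain ⟨X, Y, p₁, j₁, p₂, j₂, hl⟩ := h.decomposition l
    obtain ⟨c, hc⟩ := hk₁' X (g ≫ p₁)
      (show (F.obj.map (g ≫ p₁)).hom z = 0 by rw [LMod.map_comp_apply, hg, map_zero])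
    obtain ⟨d, hd⟩ := hk₂' Y (g ≫ p₂)
      (show (F.obj.map (g ≫ p₂)).hom z = 0 by rw [LMod.map_comp_apply, hg, map_zero])
    replace hc : k₁ ≫ i₁.map c = g ≫ p₁ := hc
    replace hd : k₂ ≫ i₂.map d = g ≫ p₂ := hd
    refine ⟨biprod.desc (i₁.map c ≫ j₁) (i₂.map d ≫ j₂), ?_⟩
    rw [biprod.lift_desc, ← Category.assoc, hc, ← Category.assoc, hd, Category.assoc,
      Category.assoc, ← Preadditive.comp_add, hl, Category.comp_id]
  · rintro ⟨m, rfl⟩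
    have : biprod.lift k₁ k₂ = k₁ ≫ biprod.inl + k₂ ≫ biprod.inr := by ext <;> simp
    rw [LMod.map_comp_apply, this, LMod.map_add_apply, LMod.map_comp_apply, LMod.map_comp_apply,
      hk₁, hk₂, map_zero, map_zero, add_zero, map_zero]

/-- Since duality commutes with restriction, it preserves finitely presented modules over a glued
category if it does so over both parts. -/
lemma IsGluing.dualsPreserveFP (h : IsGluing K i₁ i₂) (h' : IsGluing K i₁.op i₂.op)
    (hT : DualsPreserveFP K T) (hU : DualsPreserveFP K U) : DualsPreserveFP K L := by
  have := hasFiniteBiproducts_op (C := T)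
  have := hasFiniteBiproducts_op (C := U)
  have := hasFiniteBiproducts_op (C := L)
  refine ⟨fun F hF => h'.isFP ?_ ?_, fun F hF => h.isFP ?_ ?_⟩
  · exact hT.dual _ (hF.restrict i₁ h.isFP₁)
  · exact hU.dual _ (hF.restrict i₂ h.isFP₂)
  · exact hT.dualOp _ (hF.restrict i₁.op h'.isFP₁)
  · exact hU.dualOp _ (hF.restrict i₂.op h'.isFP₂)

end Gluing

/-! ### The triangular matrix category -/

section TriMatDualizing

variable {K : Type v} [Field K]
  {T : Type u₁} [Category.{v} T] [Preadditive T] [Linear K T]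
  {U : Type u₂} [Category.{v} U] [Preadditive U] [Linear K U]

lemma Bimodule.eq_zero_of_isZero_left (M : Bimodule K T U) {X : T} {Y : U} (hY : IsZero Y)
    (m : (M.bifunctor.obj (op X)).obj Y) : m = 0 := by
  rw [← M.lact_id m, hY.eq_of_src (𝟙 Y) 0]
  simp [Bimodule.lact, Functor.map_zero]

lemma Bimodule.eq_zero_of_isZero_right (M : Bimodule K T U) {X : T} {Y : U} (hX : IsZero X)
    (m : (M.bifunctor.obj (op X)).obj Y) : m = 0 := by
  have h := M.ract_smul (0 : K) m (𝟙 X)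
  rwa [zero_smul, zero_smul, hX.eq_of_src (0 : X ⟶ X) (𝟙 X), M.ract_id] at h

lemma Bimodule.zero_lact (M : Bimodule K T U) {X : T} {Y Y' : U}
    (m : (M.bifunctor.obj (op X)).obj Y) : M.lact (0 : Y ⟶ Y') m = 0 := by
  simp [Bimodule.lact, Functor.map_zero]

lemma Bimodule.ract_zero (M : Bimodule K T U) {X X' : T} {Y : U}
    (m : (M.bifunctor.obj (op X')).obj Y) : M.ract m (0 : X ⟶ X') = 0 := by
  simpa using M.ract_smul (0 : K) m (0 : X ⟶ X')

namespace TriMat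

variable {M : Bimodule K T U} {A B D : TriMat M}

lemma hom_ext {f g : A ⟶ B} (ht : f.t = g.t) (hm : f.m = g.m) (hu : f.u = g.u) : f = g :=
  Hom.ext ht hm hu

/-- The morphism with given entries. -/
def homMk (t : A.fst ⟶ B.fst) (m : (M.bifunctor.obj (op A.fst)).obj B.snd) (u : A.snd ⟶ B.snd) :
    A ⟶ B := ⟨t, m, u⟩

@[simp] lemma homMk_t (t : A.fst ⟶ B.fst) (m : (M.bifunctor.obj (op A.fst)).obj B.snd)
    (u : A.snd ⟶ B.snd) : (homMk t m u : A ⟶ B).t = t := rfl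
@[simp] lemma homMk_m (t : A.fst ⟶ B.fst) (m : (M.bifunctor.obj (op A.fst)).obj B.snd)
    (u : A.snd ⟶ B.snd) : (homMk t m u : A ⟶ B).m = m := rfl
@[simp] lemma homMk_u (t : A.fst ⟶ B.fst) (m : (M.bifunctor.obj (op A.fst)).obj B.snd)
    (u : A.snd ⟶ B.snd) : (homMk t m u : A ⟶ B).u = u := rfl
lemma smul_homMk (r : K) (t : A.fst ⟶ B.fst) (m : (M.bifunctor.obj (op A.fst)).obj B.snd)
    (u : A.snd ⟶ B.snd) : r • (homMk t m u : A ⟶ B) = homMk (r • t) (r • m) (r • u) := rfl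
@[simp] lemma id_t : (𝟙 A : A ⟶ A).t = 𝟙 A.fst := rfl
@[simp] lemma id_m : (𝟙 A : A ⟶ A).m = 0 := rfl
@[simp] lemma id_u : (𝟙 A : A ⟶ A).u = 𝟙 A.snd := rfl
@[simp] lemma comp_t (f : A ⟶ B) (g : B ⟶ D) : (f ≫ g).t = f.t ≫ g.t := rfl
@[simp] lemma comp_m (f : A ⟶ B) (g : B ⟶ D) :
    (f ≫ g).m = M.ract g.m f.t + M.lact g.u f.m := rfl
@[simp] lemma comp_u (f : A ⟶ B) (g : B ⟶ D) : (f ≫ g).u = f.u ≫ g.u := rfl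
@[simp] lemma add_t (f g : A ⟶ B) : (f + g).t = f.t + g.t := rfl
@[simp] lemma add_m (f g : A ⟶ B) : (f + g).m = f.m + g.m := rfl
@[simp] lemma add_u (f g : A ⟶ B) : (f + g).u = f.u + g.u := rfl
@[simp] lemma zero_t : (0 : A ⟶ B).t = 0 := rfl
@[simp] lemma zero_m : (0 : A ⟶ B).m = 0 := rfl
@[simp] lemma zero_u : (0 : A ⟶ B).u = 0 := rfl

attribute [local simp] Bimodule.lact_zero Bimodule.zero_lact Bimodule.zero_ract Bimodule.ract_zero

open scoped ZeroObject

/-- Isomorphisms of the diagonal entries give an isomorphism. -/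
def diagIso (e : A.fst ≅ B.fst) (e' : A.snd ≅ B.snd) : A ≅ B where
  hom := homMk e.hom 0 e'.hom
  inv := homMk e.inv 0 e'.inv
  hom_inv_id := hom_ext (by simp) (by simp) (by simp)
  inv_hom_id := hom_ext (by simp) (by simp) (by simp)

variable (M)

lemma essentiallySmall [EssentiallySmall.{v} T] [EssentiallySmall.{v} U] :
    EssentiallySmall.{v} (TriMat M) := by
  let F : SmallModel.{v} T × SmallModel.{v} U → TriMat M := fun p =>
    ⟨(equivSmallModel T).inverse.obj p.1, (equivSmallModel U).inverse.obj p.2⟩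
  have : (inducedFunctor F).EssSurj := ⟨fun A =>
    ⟨show InducedCategory _ F from ((equivSmallModel T).functor.obj A.fst,
      (equivSmallModel U).functor.obj A.snd),
    ⟨diagIso ((equivSmallModel T).unitIso.app A.fst).symm
      ((equivSmallModel U).unitIso.app A.snd).symm⟩⟩⟩
  have : (inducedFunctor F).IsEquivalence := { }
  exact EssentiallySmall.mk' (inducedFunctor F).asEquivalence.symm

lemma hasFiniteBiproducts [HasFiniteBiproducts T] [HasFiniteBiproducts U] :
    HasFiniteBiproducts (TriMat M) := by
  have := hasBinaryBiproducts_of_finite_biproducts T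
  have := hasBinaryBiproducts_of_finite_biproducts U
  have : HasBinaryBiproducts (TriMat M) := ⟨fun A B => hasBinaryBiproduct_of_total
    { pt := (⟨A.fst ⊞ B.fst, A.snd ⊞ B.snd⟩ : TriMat M)
      fst := homMk biprod.fst 0 biprod.fst
      snd := homMk biprod.snd 0 biprod.snd
      inl := homMk biprod.inl 0 biprod.inl
      inr := homMk biprod.inr 0 biprod.inr
      inl_fst := hom_ext (by simp) (by simp) (by simp)
      inl_snd := hom_ext (by simp) (by simp) (by simp)
      inr_fst := hom_ext (by simp) (by simp) (by simp)
      inr_snd := hom_ext (by simp) (by simp) (by simp) }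
    (hom_ext (by simp) (by simp) (by simp))⟩
  have hz : IsZero (⟨0, 0⟩ : TriMat M) := by
    have hT : 𝟙 (0 : T) = 0 := (isZero_zero T).eq_of_src _ _
    have hU : 𝟙 (0 : U) = 0 := (isZero_zero U).eq_of_src _ _
    rw [IsZero.iff_id_eq_zero]
    exact hom_ext hT rfl hU
  have : HasZeroObject (TriMat M) := ⟨⟨_, hz⟩⟩
  have : HasFiniteProducts (TriMat M) := hasFiniteProducts_of_has_binary_and_terminal
  exact HasFiniteBiproducts.of_hasFiniteProducts

lemma isIdempotentComplete [IsIdempotentComplete T] [IsIdempotentComplete U] :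
    IsIdempotentComplete (TriMat M) := by
  refine ⟨fun A e he => ?_⟩
  have ht : e.t ≫ e.t = e.t := congrArg (fun f => f.t) he
  have hm : M.ract e.m e.t + M.lact e.u e.m = e.m := congrArg (fun f => f.m) he
  have hu : e.u ≫ e.u = e.u := congrArg (fun f => f.u) he
  obtain ⟨X, i, p, hip, hpi⟩ := IsIdempotentComplete.idempotents_split _ _ ht
  obtain ⟨Y, j, q, hjq, hqj⟩ := IsIdempotentComplete.idempotents_split _ _ hu
  -- `m = m t + u m` implies `u m t = 0`
  have h0 : M.lact e.u (M.ract e.m e.t) = 0 := by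
    have h := congrArg (fun x => M.lact e.u (M.ract x e.t)) hm
    simp only [M.add_ract, M.lact_add, ← M.ract_comp, ht, M.lact_ract, ← M.lact_comp, hu] at h
    rw [M.lact_ract]
    simpa using h
  have hq : M.lact q (M.ract e.m i) = 0 := by
    have h := congrArg (fun x => M.lact q (M.ract x i)) h0
    simp only [← hqj, ← hpi, M.lact_ract, ← M.ract_comp, ← M.lact_comp, M.zero_ract,
      M.lact_zero, Category.assoc, hjq, Category.comp_id] at h
    rw [M.lact_ract]
    rw [← Category.assoc, hip, Category.id_comp] at h
    exact h
  refine ⟨⟨X, Y⟩, homMk i (M.ract e.m i) j, homMk p (M.lact q e.m) q, ?_, ?_⟩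
  · refine hom_ext hip ?_ hjq
    simp only [comp_m, homMk_m, homMk_t, homMk_u, id_m, hq, add_zero]
    rw [← M.lact_ract, hq]
  · refine hom_ext hpi ?_ hqj
    simp only [comp_m, homMk_m, homMk_t, homMk_u]
    rw [← M.ract_comp, ← M.lact_comp, hpi, hqj, hm]

variable {M}

lemma finite_hom (hT : ∀ X Y : T, Module.Finite K (X ⟶ Y))
    (hU : ∀ X Y : U, Module.Finite K (X ⟶ Y))
    (hM : ∀ (X : T) (Y : U), Module.Finite K ((M.bifunctor.obj (op X)).obj Y)) (A B : TriMat M) :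
    Module.Finite K (A ⟶ B) := by
  let e : ((A.fst ⟶ B.fst) × ((M.bifunctor.obj (op A.fst)).obj B.snd) × (A.snd ⟶ B.snd)) ≃ₗ[K]
      (A ⟶ B) :=
    { (homEquiv A B).symm with
      map_add' := fun _ _ => rfl
      map_smul' := fun _ _ => rfl }
  exact Module.Finite.equiv e

variable (M)

/-- The inclusion `X ↦ [[X, 0], [M, 0]]`. -/
def inclFst [HasZeroObject U] : T ⥤ TriMat M where
  obj X := ⟨X, 0⟩
  map f := homMk f 0 0
  map_id X := hom_ext rfl rfl ((isZero_zero U).eq_of_src _ _)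
  map_comp f g := hom_ext rfl (by simp) (by simp)

/-- The inclusion `Y ↦ [[0, 0], [M, Y]]`. -/
def inclSnd [HasZeroObject T] : U ⥤ TriMat M where
  obj Y := ⟨0, Y⟩
  map f := homMk 0 0 f
  map_id X := hom_ext ((isZero_zero T).eq_of_src _ _) rfl rfl
  map_comp f g := hom_ext (by simp) (by simp) rfl

instance [HasZeroObject U] : (inclFst M).Additive where
  map_add := hom_ext rfl (add_zero _).symm (add_zero _).symm

instance [HasZeroObject U] : (inclFst M).Linear K where
  map_smul {X Y} f r := by
    change homMk (r • f) 0 0 = r • (homMk f 0 0 : (⟨X, 0⟩ : TriMat M) ⟶ ⟨Y, 0⟩)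
    rw [smul_homMk, smul_zero, smul_zero]

instance [HasZeroObject T] : (inclSnd M).Additive where
  map_add := hom_ext (add_zero _).symm (add_zero _).symm rfl

instance [HasZeroObject T] : (inclSnd M).Linear K where
  map_smul {X Y} f r := by
    change homMk 0 0 (r • f) = r • (homMk 0 0 f : (⟨0, X⟩ : TriMat M) ⟶ ⟨0, Y⟩)
    rw [smul_homMk, smul_zero, smul_zero]

variable {M} [HasZeroObject T] [HasZeroObject U]

lemma diag_decomposition (A : TriMat M) :
    (homMk (𝟙 _) 0 0 : A ⟶ ⟨A.fst, 0⟩) ≫ (homMk (𝟙 _) 0 0 : ⟨A.fst, 0⟩ ⟶ A) +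
      (homMk 0 0 (𝟙 _) : A ⟶ ⟨0, A.snd⟩) ≫ (homMk 0 0 (𝟙 _) : ⟨0, A.snd⟩ ⟶ A) = 𝟙 A :=
  hom_ext (by simp) (by simp) (by simp)

variable [HasFiniteBiproducts T] [HasFiniteBiproducts U]

lemma isGluing (hM : ∀ X : T, IsFP (M.left.obj (op X))) :
    IsGluing K (inclFst M) (inclSnd M) where
  decomposition A := ⟨A.fst, A.snd, homMk (𝟙 _) 0 0, homMk (𝟙 _) 0 0, homMk 0 0 (𝟙 _),
    homMk 0 0 (𝟙 _), diag_decomposition A⟩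
  isFP₁ A := by
    refine (isFP_representable (K := K) A.fst).of_bijective (LMod.mkHom
      (fun X =>
        { toFun := fun f : A.fst ⟶ X => (homMk f 0 0 : A ⟶ (inclFst M).obj X)
          map_add' := fun f g => hom_ext rfl (add_zero _).symm (add_zero _).symm
          map_smul' := fun r f => hom_ext rfl (smul_zero r).symm (smul_zero r).symm })
      (fun X Y f g => hom_ext rfl ?_ ?_)) (fun X => ⟨fun f g h => ?_, fun (f : A ⟶ _) => ?_⟩)
    · exact (M.eq_zero_of_isZero_left (isZero_zero U) _).trans
        (M.eq_zero_of_isZero_left (isZero_zero U) _).symm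
    · exact (isZero_zero U).eq_of_tgt _ _
    · exact congrArg (fun k : A ⟶ (inclFst M).obj X => k.t) h
    · exact ⟨f.t, hom_ext rfl (M.eq_zero_of_isZero_left (isZero_zero U) _).symm
        ((isZero_zero U).eq_of_tgt _ _)⟩
  isFP₂ A := by
    refine IsFP.extension (L := M.left.obj (op A.fst)) (N := representable K A.snd)
      (LMod.mkHom (fun Y =>
        { toFun := fun m => (homMk 0 m 0 : A ⟶ (inclSnd M).obj Y)
          map_add' := fun f g => hom_ext (add_zero _).symm rfl (add_zero _).symm
          map_smul' := fun r f => hom_ext (smul_zero r).symm rfl (smul_zero r).symm })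
        (fun X Y f m => hom_ext ((isZero_zero T).eq_of_tgt _ _) ?_ ?_))
      (LMod.mkHom (fun Y =>
        { toFun := fun f : A ⟶ (inclSnd M).obj Y => f.u
          map_add' := fun f g => rfl
          map_smul' := fun r f => rfl }) (fun _ _ _ _ => rfl))
      (fun Y m m' h => congrArg (fun k : A ⟶ (inclSnd M).obj Y => k.m) h)
      (fun Y (f : A ⟶ _) => ⟨fun h => ?_, ?_⟩)
      (fun Y (f : A.snd ⟶ Y) => ⟨(homMk 0 0 f : A ⟶ (inclSnd M).obj Y), rfl⟩)
      (hM _) (isFP_representable _)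
    · exact (show M.lact f m = M.ract (0 : (M.bifunctor.obj (op (0 : T))).obj Y) (0 : A.fst ⟶ 0) +
        M.lact f m by simp)
    · exact (show (0 : A.snd ⟶ Y) = 0 ≫ f by simp)
    · exact ⟨f.m, hom_ext ((isZero_zero T).eq_of_tgt _ _) rfl h.symm⟩
    · rintro ⟨m, rfl⟩
      rfl

lemma isGluing_op (hM : ∀ Y : U, IsFP (M.right.obj Y)) :
    IsGluing K (inclFst M).op (inclSnd M).op where
  decomposition A := by
    refine ⟨op A.unop.fst, op A.unop.snd, Quiver.Hom.op (homMk (𝟙 _) 0 0),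
      Quiver.Hom.op (homMk (𝟙 _) 0 0), Quiver.Hom.op (homMk 0 0 (𝟙 _)),
      Quiver.Hom.op (homMk 0 0 (𝟙 _)), Quiver.Hom.unop_inj ?_⟩
    exact diag_decomposition A.unop
  isFP₁ A := by
    have := hasFiniteBiproducts_op (C := T)
    refine IsFP.extension (L := M.right.obj A.unop.snd) (N := representable K (op A.unop.fst))
      (LMod.mkHom (fun X =>
        { toFun := fun m => (homMk 0 m 0 : (inclFst M).obj X.unop ⟶ A.unop).op
          map_add' := fun f g => Quiver.Hom.unop_inj
            (hom_ext (add_zero _).symm rfl (add_zero _).symm)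
          map_smul' := fun r f => Quiver.Hom.unop_inj
            (hom_ext (smul_zero r).symm rfl (smul_zero r).symm) })
        (fun X Y f m => Quiver.Hom.unop_inj
          (hom_ext ?_ ?_ ((isZero_zero U).eq_of_src _ _))))
      (LMod.mkHom (fun X =>
        { toFun := fun f : A ⟶ (inclFst M).op.obj X => f.unop.t.op
          map_add' := fun f g => rfl
          map_smul' := fun r f => rfl }) (fun _ _ _ _ => rfl))
      (fun X m m' h => congrArg (fun k : A ⟶ (inclFst M).op.obj X => k.unop.m) h)
      (fun X (f : A ⟶ _) => ⟨fun h => ?_, ?_⟩)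
      (fun X (f : op A.unop.fst ⟶ X) =>
        ⟨(homMk f.unop 0 0 : (inclFst M).obj X.unop ⟶ A.unop).op, rfl⟩)
      (hM _) (isFP_representable _)
    · exact (show (0 : Y.unop ⟶ A.unop.fst) = f.unop ≫ 0 by simp)
    · exact (show M.ract m f.unop = M.ract m f.unop + M.lact (0 : (0 : U) ⟶ A.unop.snd)
        (0 : (M.bifunctor.obj (op Y.unop)).obj (0 : U)) by simp)
    · exact ⟨f.unop.m, Quiver.Hom.unop_inj
        (hom_ext (Quiver.Hom.op_inj h).symm rfl ((isZero_zero U).eq_of_src _ _))⟩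
    · rintro ⟨m, rfl⟩
      rfl
  isFP₂ A := by
    have := hasFiniteBiproducts_op (C := U)
    refine (isFP_representable (K := K) (op A.unop.snd)).of_bijective (LMod.mkHom
      (fun Y =>
        { toFun := fun f : op A.unop.snd ⟶ Y =>
            (homMk 0 0 f.unop : (inclSnd M).obj Y.unop ⟶ A.unop).op
          map_add' := fun f g => Quiver.Hom.unop_inj
            (hom_ext (add_zero _).symm (add_zero _).symm rfl)
          map_smul' := fun r f => Quiver.Hom.unop_inj
            (hom_ext (smul_zero r).symm (smul_zero r).symm rfl) })
      (fun X Y f g => Quiver.Hom.unop_inj (hom_ext ?_ ?_ rfl)))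
      (fun Y => ⟨fun f g h => ?_, fun (f : A ⟶ _) => ?_⟩)
    · exact (isZero_zero T).eq_of_src _ _
    · exact (M.eq_zero_of_isZero_right (isZero_zero T) _).trans
        (M.eq_zero_of_isZero_right (isZero_zero T) _).symm
    · exact congrArg (fun k : A ⟶ (inclSnd M).op.obj Y => k.unop.u.op) h
    · exact ⟨f.unop.u.op, Quiver.Hom.unop_inj (hom_ext ((isZero_zero T).eq_of_src _ _)
        (M.eq_zero_of_isZero_right (isZero_zero T) _).symm rfl)⟩

end TriMat

/-- The triangular matrix category over dualizing varieties is dualizing if the bimodule is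
finitely presented in each variable. -/
theorem isDualizing_triMat (hT : IsDualizing K T) (hU : IsDualizing K U) (M : Bimodule K T U)
    (hl : ∀ X : T, IsFP (M.left.obj (op X))) (hr : ∀ Y : U, IsFP (M.right.obj Y)) :
    IsDualizing K (TriMat M) := by
  have := hT.essentiallySmall
  have := hU.essentiallySmall
  have := hT.hasFiniteBiproducts
  have := hU.hasFiniteBiproducts
  have := hT.isIdempotentComplete
  have := hU.isIdempotentComplete
  have := hU.homFinite
  have := TriMat.hasFiniteBiproducts M
  exact IsDualizing.of_dualsPreserveFP
    ⟨TriMat.essentiallySmall M, TriMat.hasFiniteBiproducts M, TriMat.isIdempotentComplete M⟩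
    (TriMat.finite_hom hT.homFinite hU.homFinite fun X Y => (hl X).finite Y)
    ((TriMat.isGluing hl).dualsPreserveFP (TriMat.isGluing_op hr) hT.dualsPreserveFP
      hU.dualsPreserveFP)

/-- Both one-sided restrictions of the bimodule `Hom` are representable. -/
theorem isDualizing_triMat_hom (hT : IsDualizing K T) :
    IsDualizing K (TriMat (homBimodule K T)) := by
  have := hT.hasFiniteBiproducts
  have := hasFiniteBiproducts_op (C := T)
  refine isDualizing_triMat hT hT _ (fun X => isFP_representable X) fun Y => ?_
  refine (isFP_representable (K := K) (op Y)).of_bijective (LMod.mkHom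
    (fun X =>
      { toFun := fun f : op Y ⟶ X => f.unop
        map_add' := fun _ _ => rfl
        map_smul' := fun _ _ => rfl }) (fun _ _ _ _ => rfl)) fun X => ?_
  exact ⟨fun f g h => Quiver.Hom.unop_inj h, fun f => ⟨Quiver.Hom.op f, rfl⟩⟩

end TriMatDualizing

/-! ### Injective objects in a dualizing abelian variety -/

section Injectives

variable {K : Type v} [Field K] {C : Type u} [Category.{v} C] [Abelian C] [Linear K C]

/-- For a projective object `P` the module `D C(P, -)` is representable: it is finitely presented,
so that it is the cokernel of some `C(-, X₁) ⟶ C(-, X₀)`, and being left exact it is represented by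
the cokernel of `X₁ ⟶ X₀`. -/
lemma exists_nakayama (hd : DualsPreserveFP K C) (P : C) [Projective P] :
    ∃ (I : C) (ξ : (P ⟶ I) →ₗ[K] K), ∀ (Y : C) (η : (P ⟶ Y) →ₗ[K] K),
      ∃! g : Y ⟶ I, ∀ a : P ⟶ Y, ξ (a ≫ g) = η a := by
  have := Abelian.hasFiniteBiproducts (C := C)
  have := hasFiniteBiproducts_op (C := C)
  obtain ⟨X₀, X₁, f, ξ₀, h⟩ := isFP_iff.1 (hd.dual _ (isFP_representable (K := K) P))
  let ξ₁ : (P ⟶ X₀.unop) →ₗ[K] K := ξ₀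
  have hgen : ∀ (Y : C) (η : (P ⟶ Y) →ₗ[K] K), ∃ g : Y ⟶ X₀.unop, ∀ a, ξ₁ (a ≫ g) = η a := by
    intro Y η
    obtain ⟨g, hg⟩ := h.gen (op Y) η
    exact ⟨g.unop, fun a => congrArg (fun t : (P ⟶ Y) →ₗ[K] K => t a) hg⟩
  have hrel : ∀ {Y : C} (g : Y ⟶ X₀.unop),
      (∀ a : P ⟶ Y, ξ₁ (a ≫ g) = 0) ↔ ∃ k, g = k ≫ f.unop := by
    intro Y g
    refine Iff.trans ?_ ((h.rel g.op).trans ⟨?_, ?_⟩)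
    · exact ⟨fun h => LinearMap.ext h, fun h a => congrArg (fun t : (P ⟶ Y) →ₗ[K] K => t a) h⟩
    · rintro ⟨k, hk⟩
      exact ⟨k.unop, Quiver.Hom.op_inj hk⟩
    · rintro ⟨k, rfl⟩
      exact ⟨k.op, rfl⟩
  let c := cokernel.π f.unop
  -- `P` being projective, `C(P, -)` is exact, and `ξ₁` descends to the cokernel
  obtain ⟨ξ, hξ⟩ : ∃ ξ : (P ⟶ cokernel f.unop) →ₗ[K] K, ∀ a, ξ (a ≫ c) = ξ₁ a := by
    have hmem : ξ₁ ∈ LinearMap.range (Linear.rightComp K P c).dualMap := by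
      rw [LinearMap.range_dualMap_eq_dualAnnihilator_ker, Submodule.mem_dualAnnihilator]
      intro a (ha : a ≫ c = 0)
      have hex := ShortComplex.exact_cokernel f.unop
      rw [← hex.liftFromProjective_comp a ha]
      exact (hrel _).2 ⟨𝟙 _, (Category.id_comp _).symm⟩ _
    obtain ⟨ξ, hξ⟩ := hmem
    exact ⟨ξ, fun a => congrArg (fun t => t a) hξ⟩
  refine ⟨cokernel f.unop, ξ, fun Y η => ?_⟩
  obtain ⟨g, hg⟩ := hgen Y η
  refine ⟨g ≫ c, fun a => by rw [← Category.assoc, hξ, hg], fun g' hg' => ?_⟩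
  rw [← sub_eq_zero]
  obtain ⟨Y', e, _, k, hk⟩ := surjective_up_to_refinements_of_epi c (g' - g ≫ c)
  obtain ⟨l, hl⟩ := (hrel k).1 fun a => by
    rw [← hξ, Category.assoc, ← hk, ← Category.assoc, Preadditive.comp_sub, map_sub, hg',
      ← Category.assoc, hξ, hg, sub_self]
  rw [← cancel_epi e, hk, hl, Category.assoc, cokernel.condition, comp_zero, comp_zero]

/-- An object representing `D C(P, -)`, for `P` projective, is injective, because this functor takes
monomorphisms to surjections. -/
lemma injective_of_represents {P I : C} [Projective P] (ξ : (P ⟶ I) →ₗ[K] K)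
    (h : ∀ (Y : C) (η : (P ⟶ Y) →ₗ[K] K), ∃! g : Y ⟶ I, ∀ a : P ⟶ Y, ξ (a ≫ g) = η a) :
    Injective I where
  factors {Y Y'} g m _ := by
    have hm : Function.Injective (Linear.rightComp K P m) := fun a b hab => (cancel_mono m).1 hab
    obtain ⟨η, hη⟩ := LinearMap.dualMap_surjective_of_injective hm
      (ξ ∘ₗ Linear.rightComp K P g)
    obtain ⟨g', hg', -⟩ := h Y' η
    refine ⟨g', (h Y (ξ ∘ₗ Linear.rightComp K P g)).unique (fun a => ?_) (fun a => rfl)⟩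
    rw [← Category.assoc, hg']
    exact congrArg (fun t => t a) hη

/-- A dualizing abelian variety with enough projectives has enough injectives. If `ξ ∈ D C(Y, X)`
generates the module `D C(-, X)` and `P ⟶ Y` is an epimorphism from a projective object, then an
extension of `ξ` to `C(P, X)` corresponds to a monomorphism from `X` to the injective object
representing `D C(P, -)`. -/
lemma enoughInjectives_of_dualsPreserveFP [EnoughProjectives C] (hd : DualsPreserveFP K C) :
    EnoughInjectives C := by
  have := Abelian.hasFiniteBiproducts (C := C)
  have := hasFiniteBiproducts_op (C := C)
  refine ⟨fun X => ?_⟩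
  have hX : IsFP (representable K (op X)) := isFP_representable (K := K) (op X)
  obtain ⟨Y, ξ, hξ⟩ := (hd.dualOp _ hX).isFG.exists_generator
  let e : (Y ⟶ X) ≃ₗ[K] (op X ⟶ op Y) :=
    { toFun := fun f => f.op
      invFun := fun f => f.unop
      map_add' := fun _ _ => rfl
      map_smul' := fun _ _ => rfl }
  let ξ₁ : (Y ⟶ X) →ₗ[K] K := LinearMap.comp (show (op X ⟶ op Y) →ₗ[K] K from ξ) e.toLinearMap
  have hq : Function.Injective (Linear.leftComp K X (Projective.π Y)) :=
    fun a b hab => (cancel_epi (Projective.π Y)).1 hab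
  obtain ⟨ξ', hξ'⟩ := LinearMap.dualMap_surjective_of_injective hq ξ₁
  obtain ⟨I, ζ, hI⟩ := exists_nakayama hd (Projective.over Y)
  have := injective_of_represents ζ hI
  obtain ⟨μ, hμ, -⟩ := hI X ξ'
  refine ⟨⟨I, inferInstance, μ, Preadditive.mono_of_cancel_zero _ fun {Z} h hh => ?_⟩⟩
  -- a functional on `C(Z, X)` that does not vanish at `h`
  by_contra hne
  apply hne
  have h0 : ∀ η : Module.Dual K (Z ⟶ X), η h = 0 := by
    intro η
    let η₁ : (op X ⟶ op Z) →ₗ[K] K := η ∘ₗ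
      { toFun := fun f => f.unop
        map_add' := fun _ _ => rfl
        map_smul' := fun _ _ => rfl }
    obtain ⟨g, hg⟩ := hξ Z η₁
    have h₁ : ξ₁ (g ≫ h) = η h := congrArg (fun t : (op X ⟶ op Z) →ₗ[K] K => t h.op) hg
    have h₂ : ξ' (Projective.π Y ≫ g ≫ h) = ξ₁ (g ≫ h) := congrArg (fun t => t (g ≫ h)) hξ'
    rw [← h₁, ← h₂, ← hμ, Category.assoc, Category.assoc, hh, comp_zero, comp_zero, map_zero]
  exact (Module.forall_dual_apply_eq_zero_iff K h).1 h0

end Injectives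

/-! ### The tensor product with a bimodule -/

section Tensor

open scoped TensorProduct DirectSum

variable {K : Type v} [Field K]
  {T : Type u₁} [Category.{v} T] [Preadditive T] [Linear K T]
  {U : Type u₂} [Category.{v} U] [Preadditive U] [Linear K U]

section

variable [EssentiallySmall.{v} U] (M : Bimodule K T U)

/-- The elements of `𝔾(B)(X)` are the morphisms `M_X ⟶ B`. -/
def homOfG (B : LMod K U) (X : T) : (M.G.obj B).obj.obj X ≃ₗ[K] (M.left.obj (op X) ⟶ B) :=
  Shrink.linearEquiv.{v} K (M.left.obj (op X) ⟶ B)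

lemma homOfG_map (B : LMod K U) {X X' : T} (t : X ⟶ X') (x : (M.G.obj B).obj.obj X) :
    homOfG M B X' (((M.G.obj B).obj.map t).hom x) = M.left.map t.op ≫ homOfG M B X x :=
  linearEquiv_shrinkMap _ _

lemma homOfG_map_app {B B' : LMod K U} (β : B ⟶ B') (X : T) (x : (M.G.obj B).obj.obj X) :
    homOfG M B' X (((M.G.map β).hom.app X).hom x) = homOfG M B X x ≫ β :=
  linearEquiv_shrinkMap _ _

/-- The bilinear map `A(X) × M(Y, X) ⟶ B(Y)` given by a morphism `A ⟶ 𝔾(B)`. -/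
def bilinOfG {A : LMod K T} {B : LMod K U} (ψ : A ⟶ M.G.obj B) (Y : U) (X : T) :
    A.obj.obj X →ₗ[K] (M.bifunctor.obj (op X)).obj Y →ₗ[K] B.obj.obj Y :=
  LinearMap.mk₂ K (fun a m => ((homOfG M B X ((ψ.hom.app X).hom a)).hom.app Y).hom m)
    (fun a a' m => by rw [map_add, map_add]; rfl)
    (fun r a m => by rw [map_smul, map_smul]; rfl)
    (fun a m m' => map_add _ _ _)
    (fun r a m => map_smul _ _ _)

lemma bilinOfG_balanced {A : LMod K T} {B : LMod K U} (ψ : A ⟶ M.G.obj B) (Y : U) ⦃X' X : T⦄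
    (t : X' ⟶ X) (a : A.obj.obj X') (m : (M.bifunctor.obj (op X)).obj Y) :
    bilinOfG M ψ Y X ((A.obj.map t).hom a) m = bilinOfG M ψ Y X' a (M.ract m t) := by
  change ((homOfG M B X ((ψ.hom.app X).hom ((A.obj.map t).hom a))).hom.app Y).hom m = _
  rw [LMod.naturality_apply, homOfG_map]
  rfl

end

variable [EssentiallySmall.{v} T] (M : Bimodule K T U) (A : LMod K T)

/-- The direct sum of the spaces `A(X) ⊗ M(Y, X)`, for `X` in a small model of `T`. -/
abbrev PreTensor (Y : U) : Type v :=
  ⨁ j : SmallModel.{v} T, A.obj.obj ((equivSmallModel T).inverse.obj j) ⊗[K]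
    (M.bifunctor.obj (op ((equivSmallModel T).inverse.obj j))).obj Y

variable {M A} in
/-- The class of `a ⊗ m` in the summand of index `j`. -/
def PreTensor.of {Y : U} (j : SmallModel.{v} T)
    (a : A.obj.obj ((equivSmallModel T).inverse.obj j))
    (m : (M.bifunctor.obj (op ((equivSmallModel T).inverse.obj j))).obj Y) : PreTensor M A Y :=
  open scoped Classical in
  DirectSum.lof K _ (fun j : SmallModel.{v} T =>
    A.obj.obj ((equivSmallModel T).inverse.obj j) ⊗[K]
    (M.bifunctor.obj (op ((equivSmallModel T).inverse.obj j))).obj Y) j (a ⊗ₜ m)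

/-- The relations `t a ⊗ m = a ⊗ m t`. -/
def tensorRel (Y : U) : Submodule K (PreTensor M A Y) :=
  Submodule.span K {z | ∃ (j j' : SmallModel.{v} T) (s : j' ⟶ j) (a : _) (m : _),
    z = PreTensor.of j ((A.obj.map ((equivSmallModel T).inverse.map s)).hom a) m -
      PreTensor.of j' a (M.ract m ((equivSmallModel T).inverse.map s))}

/-- The value at `Y` of the tensor product `A ⊗_T M`, i.e. the coend of `A(X) ⊗ M(Y, X)` over `X`.
It is formed over a small model of `T` in order to stay in the universe of `K`. -/
def TensorSpace (Y : U) : Type v := PreTensor M A Y ⧸ tensorRel M A Y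

instance (Y : U) : AddCommGroup (TensorSpace M A Y) :=
  inferInstanceAs (AddCommGroup (PreTensor M A Y ⧸ tensorRel M A Y))

instance (Y : U) : Module K (TensorSpace M A Y) :=
  inferInstanceAs (Module K (PreTensor M A Y ⧸ tensorRel M A Y))

/-- The projection onto the tensor product. -/
def TensorSpace.mk (Y : U) : PreTensor M A Y →ₗ[K] TensorSpace M A Y :=
  Submodule.mkQ _

variable {M A}

/-- The element `a ⊗ m` of `A ⊗_T M`, for an arbitrary object `X` of `T`. -/
def ten (X : T) (Y : U) (a : A.obj.obj X) (m : (M.bifunctor.obj (op X)).obj Y) :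
    TensorSpace M A Y :=
  TensorSpace.mk M A Y (PreTensor.of ((equivSmallModel T).functor.obj X)
    ((A.obj.map ((equivSmallModel T).unitIso.hom.app X)).hom a)
    (M.ract m ((equivSmallModel T).unitIso.inv.app X)))

variable {X X' : T} {Y : U}

lemma ten_add_left (a a' : A.obj.obj X) (m : (M.bifunctor.obj (op X)).obj Y) :
    ten X Y (a + a') m = ten X Y a m + ten X Y a' m := by
  simp only [ten, PreTensor.of, map_add, TensorProduct.add_tmul]

lemma ten_smul_left (r : K) (a : A.obj.obj X) (m : (M.bifunctor.obj (op X)).obj Y) :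
    ten X Y (r • a) m = r • ten X Y a m := by
  simp only [ten, PreTensor.of, map_smul, ← TensorProduct.smul_tmul']

lemma ten_add_right (a : A.obj.obj X) (m m' : (M.bifunctor.obj (op X)).obj Y) :
    ten X Y a (m + m') = ten X Y a m + ten X Y a m' := by
  simp only [ten, PreTensor.of, M.add_ract, map_add, TensorProduct.tmul_add]

lemma ten_smul_right (r : K) (a : A.obj.obj X) (m : (M.bifunctor.obj (op X)).obj Y) :
    ten X Y a (r • m) = r • ten X Y a m := by
  simp only [ten, PreTensor.of, M.smul_ract, map_smul, TensorProduct.tmul_smul]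

lemma mk_of_map_eq {j j' : SmallModel.{v} T} (s : j' ⟶ j) (a : _)
    (m : (M.bifunctor.obj (op ((equivSmallModel T).inverse.obj j))).obj Y) :
    TensorSpace.mk M A Y
      (PreTensor.of j ((A.obj.map ((equivSmallModel T).inverse.map s)).hom a) m) =
      TensorSpace.mk M A Y (PreTensor.of j' a (M.ract m ((equivSmallModel T).inverse.map s))) :=
  (Submodule.Quotient.eq _).2 (Submodule.subset_span ⟨j, j', s, a, m, rfl⟩)

lemma ten_map (t : X' ⟶ X) (a : A.obj.obj X') (m : (M.bifunctor.obj (op X)).obj Y) :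
    ten X Y ((A.obj.map t).hom a) m = ten X' Y a (M.ract m t) := by
  have h₁ := (equivSmallModel T).unitIso.hom.naturality t
  have h₂ := (equivSmallModel T).unitIso.inv.naturality t
  simp only [Functor.id_map, Functor.comp_map] at h₁ h₂
  rw [ten, ten, ← LMod.map_comp_apply, ← M.ract_comp]
  refine Eq.trans (congrArg (fun k => TensorSpace.mk M A Y (PreTensor.of _
    ((A.obj.map k).hom a) _)) h₁) ?_
  refine Eq.trans ?_ (congrArg (fun k => TensorSpace.mk M A Y (PreTensor.of _ _
    (M.ract m k))) h₂)
  rw [LMod.map_comp_apply]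
  erw [M.ract_comp]
  exact mk_of_map_eq _ _ _

/-- A tensor over an object of the small model is the class of the corresponding summand. -/
lemma ten_inverse_obj (j : SmallModel.{v} T) (a : A.obj.obj ((equivSmallModel T).inverse.obj j))
    (m : (M.bifunctor.obj (op ((equivSmallModel T).inverse.obj j))).obj Y) :
    ten _ Y a m = TensorSpace.mk M A Y (PreTensor.of j a m) := by
  obtain ⟨s, hs⟩ := (equivSmallModel T).inverse.map_surjective
    ((equivSmallModel T).unitIso.hom.app ((equivSmallModel T).inverse.obj j))
  rw [ten, ← hs]
  refine (mk_of_map_eq _ _ _).trans ?_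
  rw [hs]
  erw [← M.ract_comp]
  simp only [Iso.hom_inv_id_app]
  erw [M.ract_id]

lemma tensorSpace_hom_ext {W : Type*} [AddCommGroup W] [Module K W]
    {φ ψ : TensorSpace M A Y →ₗ[K] W} (h : ∀ X a m, φ (ten X Y a m) = ψ (ten X Y a m)) :
    φ = ψ := by
  classical
  refine Submodule.linearMap_qext _ (DirectSum.linearMap_ext _ fun j =>
    TensorProduct.ext' fun a m => ?_)
  have := h _ a m
  rw [ten_inverse_obj] at this
  exact this

section Lift

variable {W : Type*} [AddCommGroup W] [Module K W]
  (β : ∀ X : T, A.obj.obj X →ₗ[K] (M.bifunctor.obj (op X)).obj Y →ₗ[K] W)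
  (hβ : ∀ ⦃X' X : T⦄ (t : X' ⟶ X) a m, β X ((A.obj.map t).hom a) m = β X' a (M.ract m t))

/-- The linear map out of the tensor product given by a balanced family of bilinear maps. -/
def tensorLift : TensorSpace M A Y →ₗ[K] W :=
  open scoped Classical in
  Submodule.liftQ _ (DirectSum.toModule K _ _ fun j => TensorProduct.lift (β _)) (by
    rw [tensorRel, Submodule.span_le]
    rintro _ ⟨j, j', s, a, m, rfl⟩
    simp only [SetLike.mem_coe, LinearMap.mem_ker, map_sub, PreTensor.of, DirectSum.toModule_lof,
      TensorProduct.lift.tmul, hβ, sub_self])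

lemma tensorLift_ten (X : T) (a : A.obj.obj X) (m : (M.bifunctor.obj (op X)).obj Y) :
    tensorLift β hβ (ten X Y a m) = β X a m := by
  classical
  have h : tensorLift β hβ (ten X Y a m) =
      β _ ((A.obj.map ((equivSmallModel T).unitIso.hom.app X)).hom a)
        (M.ract m ((equivSmallModel T).unitIso.inv.app X)) := by
    rw [tensorLift, ten]
    refine (Submodule.liftQ_apply _ _ _).trans ?_
    rw [PreTensor.of, DirectSum.toModule_lof, TensorProduct.lift.tmul]
    rfl
  rw [h, hβ]
  erw [← M.ract_comp]
  simp only [Iso.hom_inv_id_app]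
  erw [M.ract_id]
  rfl

end Lift

variable (M A)

/-- The map of tensor products induced by a morphism of `U`. -/
def tensorMap {Y Y' : U} (u : Y ⟶ Y') : TensorSpace M A Y →ₗ[K] TensorSpace M A Y' :=
  tensorLift (fun X => LinearMap.mk₂ K (fun a m => ten X Y' a (M.lact u m))
    (fun _ _ _ => ten_add_left _ _ _) (fun _ _ _ => ten_smul_left _ _ _)
    (fun _ _ _ => by rw [M.lact_add, ten_add_right])
    (fun _ _ _ => by rw [M.lact_smul, ten_smul_right]))
    (fun X' X t a m => by
      simp only [LinearMap.mk₂_apply]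
      rw [ten_map, M.lact_ract])

variable {M A} in
lemma tensorMap_ten {Y Y' : U} (u : Y ⟶ Y') (a : A.obj.obj X)
    (m : (M.bifunctor.obj (op X)).obj Y) :
    tensorMap M A u (ten X Y a m) = ten X Y' a (M.lact u m) :=
  tensorLift_ten _ _ _ _ _

lemma tensorMap_id (Y : U) : tensorMap M A (𝟙 Y) = LinearMap.id :=
  tensorSpace_hom_ext fun X a m => by rw [tensorMap_ten, M.lact_id, LinearMap.id_apply]

lemma tensorMap_comp {Y Y' Y'' : U} (u : Y ⟶ Y') (u' : Y' ⟶ Y'') :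
    tensorMap M A (u ≫ u') = tensorMap M A u' ∘ₗ tensorMap M A u :=
  tensorSpace_hom_ext fun X a m => by
    rw [tensorMap_ten, M.lact_comp, LinearMap.comp_apply, tensorMap_ten, tensorMap_ten]

lemma tensorMap_add {Y Y' : U} (u u' : Y ⟶ Y') :
    tensorMap M A (u + u') = tensorMap M A u + tensorMap M A u' :=
  tensorSpace_hom_ext fun X a m => by
    rw [tensorMap_ten, M.add_lact, ten_add_right, LinearMap.add_apply, tensorMap_ten,
      tensorMap_ten]

lemma tensorMap_smul {Y Y' : U} (r : K) (u : Y ⟶ Y') :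
    tensorMap M A (r • u) = r • tensorMap M A u :=
  tensorSpace_hom_ext fun X a m => by
    rw [tensorMap_ten, M.smul_lact, ten_smul_right, LinearMap.smul_apply, tensorMap_ten]

/-- The tensor product `A ⊗_T M`, a module over `U`. -/
def tensorObj : LMod K U where
  obj :=
    { obj := fun Y => ModuleCat.of K (TensorSpace M A Y)
      map := fun u => ModuleCat.ofHom (tensorMap M A u)
      map_id := fun Y => ModuleCat.hom_ext (tensorMap_id M A Y)
      map_comp := fun u u' => ModuleCat.hom_ext (tensorMap_comp M A u u') }
  property := ⟨⟨ModuleCat.hom_ext (tensorMap_add M A _ _)⟩,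
    ⟨fun u r => ModuleCat.hom_ext (tensorMap_smul M A r u)⟩⟩

/-- The linear map `A(X) ⟶ Hom(M_X, B)` given by a morphism `A ⊗_T M ⟶ B`. -/
def curryTensor {A : LMod K T} {B : LMod K U} (φ : tensorObj M A ⟶ B) (X : T) :
    A.obj.obj X →ₗ[K] (M.left.obj (op X) ⟶ B) where
  toFun a := LMod.mkHom (fun Y =>
    { toFun := fun m => (φ.hom.app Y).hom (ten X Y a m)
      map_add' := fun m m' => (congrArg (φ.hom.app Y).hom (ten_add_right a m m')).trans
        (map_add (φ.hom.app Y).hom _ _)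
      map_smul' := fun r m => (congrArg (φ.hom.app Y).hom (ten_smul_right r a m)).trans
        (map_smul (φ.hom.app Y).hom _ _) })
    (fun Y Y' u m => by
      refine Eq.trans ?_ (LMod.naturality_apply φ u (ten X Y a m))
      exact congrArg (φ.hom.app Y').hom (tensorMap_ten u a m).symm)
  map_add' a a' := LMod.hom_ext' fun Y m =>
    (congrArg (φ.hom.app Y).hom (ten_add_left a a' m)).trans (map_add (φ.hom.app Y).hom _ _)
  map_smul' r a := LMod.hom_ext' fun Y m =>
    (congrArg (φ.hom.app Y).hom (ten_smul_left r a m)).trans (map_smul (φ.hom.app Y).hom _ _)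

variable [EssentiallySmall.{v} U]

/-- The morphism `A ⟶ 𝔾(B)` corresponding to `A ⊗_T M ⟶ B`. -/
def toG {A : LMod K T} {B : LMod K U} (φ : tensorObj M A ⟶ B) : A ⟶ M.G.obj B :=
  LMod.mkHom (fun X => (homOfG M B X).symm.toLinearMap ∘ₗ curryTensor M φ X)
    (fun X X' t a => by
      apply (homOfG M B X').injective
      rw [homOfG_map]
      refine (LinearEquiv.apply_symm_apply _ _).trans ?_
      refine Eq.trans ?_ (congrArg _ (LinearEquiv.apply_symm_apply _ _).symm)
      exact LMod.hom_ext' fun Y m => congrArg (φ.hom.app Y).hom (ten_map t a m))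

lemma homOfG_toG {A : LMod K T} {B : LMod K U} (φ : tensorObj M A ⟶ B) (X : T)
    (a : A.obj.obj X) : homOfG M B X (((toG M φ).hom.app X).hom a) = curryTensor M φ X a :=
  LinearEquiv.apply_symm_apply _ _

/-- The morphism `A ⊗_T M ⟶ B` corresponding to `A ⟶ 𝔾(B)`. -/
def ofG {A : LMod K T} {B : LMod K U} (ψ : A ⟶ M.G.obj B) : tensorObj M A ⟶ B :=
  LMod.mkHom (M := tensorObj M A)
    (fun Y => tensorLift (bilinOfG M ψ Y) (bilinOfG_balanced M ψ Y))
    (fun Y Y' u x => by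
      have h : tensorLift (bilinOfG M ψ Y') (bilinOfG_balanced M ψ Y') ∘ₗ tensorMap M A u =
          (B.obj.map u).hom ∘ₗ tensorLift (bilinOfG M ψ Y) (bilinOfG_balanced M ψ Y) := by
        refine tensorSpace_hom_ext fun X a m => ?_
        rw [LinearMap.comp_apply, LinearMap.comp_apply, tensorMap_ten, tensorLift_ten,
          tensorLift_ten]
        exact LMod.naturality_apply (homOfG M B X ((ψ.hom.app X).hom a)) u m
      exact congrArg (fun k => k x) h)

lemma ofG_ten {A : LMod K T} {B : LMod K U} (ψ : A ⟶ M.G.obj B) (X : T) (Y : U)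
    (a : A.obj.obj X) (m : (M.bifunctor.obj (op X)).obj Y) :
    ((ofG M ψ).hom.app Y).hom (ten X Y a m) =
      ((homOfG M B X ((ψ.hom.app X).hom a)).hom.app Y).hom m :=
  tensorLift_ten (bilinOfG M ψ Y) (bilinOfG_balanced M ψ Y) X a m

/-- The tensor-hom adjunction `Hom(A ⊗_T M, B) ≃ Hom(A, 𝔾(B))`. -/
def tensorHomEquiv (A : LMod K T) (B : LMod K U) : (tensorObj M A ⟶ B) ≃ (A ⟶ M.G.obj B) where
  toFun := toG M
  invFun := ofG M
  left_inv φ := by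
    refine ObjectProperty.hom_ext _ (NatTrans.ext (funext fun Y => ModuleCat.hom_ext
      (tensorSpace_hom_ext (M := M) (A := A) fun X a m => ?_)))
    refine (ofG_ten M (toG M φ) X Y a m).trans ?_
    rw [homOfG_toG]
    rfl
  right_inv ψ := by
    refine LMod.hom_ext' fun X a => ?_
    apply (homOfG M B X).injective
    rw [homOfG_toG]
    exact LMod.hom_ext' fun Y m => ofG_ten M ψ X Y a m

lemma tensorHomEquiv_naturality (A : LMod K T) (B B' : LMod K U) (β : B ⟶ B')
    (φ : tensorObj M A ⟶ B) :
    tensorHomEquiv M A B' (φ ≫ β) = tensorHomEquiv M A B φ ≫ M.G.map β := by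
  refine LMod.hom_ext' fun X a => ?_
  apply (homOfG M B' X).injective
  refine (homOfG_toG M _ X a).trans (Eq.trans ?_ (homOfG_map_app M β X _).symm)
  refine Eq.trans ?_ (congrArg (fun k => k ≫ β) (homOfG_toG M φ X a).symm)
  exact LMod.hom_ext' fun Y m => rfl

/-- The functor `A ↦ A ⊗_T M` is left adjoint to `𝔾`. -/
def tensorAdjunction :
    Adjunction.leftAdjointOfEquiv (tensorHomEquiv M) (tensorHomEquiv_naturality M) ⊣ M.G :=
  Adjunction.adjunctionOfEquivLeft _ _

lemma isRightAdjoint_G : M.G.IsRightAdjoint := (tensorAdjunction M).isRightAdjoint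

/-- The chosen left adjoint of `𝔾` is the tensor product with `M`. -/
def leftAdjointObjIso [M.G.IsRightAdjoint] (A : LMod K T) :
    M.G.leftAdjoint.obj A ≅ tensorObj M A :=
  ((Adjunction.ofIsRightAdjoint M.G).leftAdjointUniq (tensorAdjunction M)).app A

end Tensor

/-! ### The dual of a tensor product -/

section DualTensor

variable {K : Type v} [Field K]
  {T : Type u₁} [Category.{v} T] [Preadditive T] [Linear K T]
  {U : Type u₂} [Category.{v} U] [Preadditive U] [Linear K U]
  [EssentiallySmall.{v} T] {M : Bimodule K T U} (A : LMod K T)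

/-- For an element `c ∈ M(Y, X)` the map from the dual of `(A ⊗_T M)(Y)` to that of `A(X)` given by
`ζ ↦ ζ(- ⊗ c)`. -/
def dualTensorMap {X : Tᵒᵖ} {Y : U} (c : (M.right.obj Y).obj.obj X) :
    Module.Dual K (TensorSpace M A Y) →ₗ[K] Module.Dual K (A.obj.obj X.unop) where
  toFun ζ :=
    { toFun := fun a => ζ (ten X.unop Y a c)
      map_add' := fun a a' => (congrArg ζ (ten_add_left a a' c)).trans (map_add ζ _ _)
      map_smul' := fun r a => (congrArg ζ (ten_smul_left r a c)).trans (map_smul ζ _ _) }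
  map_add' _ _ := rfl
  map_smul' _ _ := rfl

lemma dualTensorMap_apply {X : Tᵒᵖ} {Y : U} (c : (M.right.obj Y).obj.obj X)
    (ζ : Module.Dual K (TensorSpace M A Y)) (a : A.obj.obj X.unop) :
    dualTensorMap A c ζ a = ζ (ten X.unop Y a c) := rfl

variable {A}
variable {X₀ X₁ : Tᵒᵖ} {Y : U} {f : X₀ ⟶ X₁} {c : (M.right.obj Y).obj.obj X₀}
  (h : IsPresentation (M.right.obj Y) f c)

lemma ten_eq_of_map_eq {X : T} (g : X₀ ⟶ op X) (a : A.obj.obj X)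
    (m : (M.bifunctor.obj (op X)).obj Y) (hg : ((M.right.obj Y).obj.map g).hom c = m) :
    ten X Y a m = ten X₀.unop Y ((A.obj.map g.unop).hom a) c := by
  subst hg
  exact (ten_map g.unop a c).symm

include h in
lemma dualTensorMap_injective : Function.Injective (dualTensorMap A c) := by
  intro ζ ζ' hζ
  refine tensorSpace_hom_ext fun X a m => ?_
  obtain ⟨g, hg⟩ := h.gen (op X) m
  rw [ten_eq_of_map_eq g a m hg]
  exact congrArg (fun t => t ((A.obj.map g.unop).hom a)) hζ

include h in
/-- The dual of `(A ⊗_T M)(Y)` in terms of a presentation of `M_Y`: the tensor product is the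
cokernel of `A(X₁) ⟶ A(X₀)`. -/
lemma mem_range_dualTensorMap (ξ : Module.Dual K (A.obj.obj X₀.unop)) :
    ξ ∈ LinearMap.range (dualTensorMap A c) ↔
      ∀ a : A.obj.obj X₁.unop, ξ ((A.obj.map f.unop).hom a) = 0 := by
  constructor
  · rintro ⟨ζ, rfl⟩ a
    have hc : M.ract (X := X₁.unop) (X' := X₀.unop) c f.unop = 0 := (h.rel f).2 ⟨𝟙 _, by simp⟩
    have h0 := ten_smul_right (M := M) (A := A) (X := X₁.unop) (Y := Y) (0 : K) a 0
    rw [zero_smul, zero_smul] at h0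
    refine (congrArg ζ ((ten_map f.unop a c).trans ?_)).trans (map_zero ζ)
    exact (congrArg (ten X₁.unop Y a) hc).trans h0
  · intro hξ
    -- `ξ(g a)` depends only on `c g`
    have hwd : ∀ {X : T} (g g' : X₀ ⟶ op X) (a : A.obj.obj X),
        ((M.right.obj Y).obj.map g).hom c = ((M.right.obj Y).obj.map g').hom c →
        ξ ((A.obj.map g.unop).hom a) = ξ ((A.obj.map g'.unop).hom a) := by
      intro X g g' a hgg
      obtain ⟨k, hk⟩ := (h.rel (g - g')).1 (by rw [LMod.map_sub_apply, hgg, sub_self])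
      have hk' : g.unop - g'.unop = k.unop ≫ f.unop := congrArg Quiver.Hom.unop hk
      rw [← sub_eq_zero, ← map_sub, ← LMod.map_sub_apply, hk', LMod.map_comp_apply, hξ]
    choose s hs using fun (X : T) (m : (M.right.obj Y).obj.obj (op X)) => h.gen (op X) m
    let β : ∀ X : T, A.obj.obj X →ₗ[K] (M.bifunctor.obj (op X)).obj Y →ₗ[K] K := fun X =>
      LinearMap.mk₂ K (fun a m => ξ ((A.obj.map (s X m).unop).hom a))
        (fun a a' m => by rw [map_add, map_add])
        (fun r a m => by rw [map_smul, map_smul])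
        (fun a m m' => by
          rw [← map_add, ← LMod.map_add_apply]
          refine hwd _ (s X m + s X m') _ ?_
          exact (hs X (m + m')).trans ((LMod.map_add_apply _ _ _ _).trans
            (congrArg₂ (fun x y => x + y) (hs X m) (hs X m'))).symm)
        (fun r a m => by
          rw [← map_smul, ← LMod.map_smul_apply]
          refine hwd _ (r • s X m) _ ?_
          exact (hs X (r • m)).trans ((LMod.map_smul_apply _ _ _ _).trans
            (congrArg (fun x => r • x) (hs X m))).symm)
    have hβ : ∀ ⦃X' X : T⦄ (t : X' ⟶ X) a m,
        β X ((A.obj.map t).hom a) m = β X' a (M.ract m t) := by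
      intro X' X t a m
      change ξ _ = ξ _
      rw [← LMod.map_comp_apply]
      refine hwd (s X m ≫ t.op) _ a ?_
      exact ((LMod.map_comp_apply _ _ _ _).trans (congrArg _ (hs X m))).trans (hs X' _).symm
    refine ⟨tensorLift β hβ, LinearMap.ext fun a => ?_⟩
    refine (tensorLift_ten β hβ X₀.unop a c).trans ?_
    refine (hwd _ (𝟙 X₀) a ((hs _ _).trans (LMod.map_id_apply _ _).symm)).trans ?_
    exact congrArg ξ (A.map_id_apply a)

lemma dualTensorMap_naturality {X X' : Tᵒᵖ} {Y Y' : U} (c : (M.right.obj Y).obj.obj X)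
    (c' : (M.right.obj Y').obj.obj X') (u : Y ⟶ Y') (ψ : X' ⟶ X)
    (hc : ((M.right.map u).hom.app X).hom c = ((M.right.obj Y').obj.map ψ).hom c')
    (ζ : Module.Dual K (TensorSpace M A Y')) :
    dualTensorMap A c (ζ ∘ₗ tensorMap M A u) =
      dualTensorMap A c' ζ ∘ₗ (A.obj.map ψ.unop).hom := by
  refine LinearMap.ext fun a => ?_
  exact congrArg ζ ((tensorMap_ten u a c).trans (ten_eq_of_map_eq ψ a _ hc.symm))

end DualTensor

/-! ### Left derived functors of right exact functors -/

section Derived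

variable {K : Type v} [Field K]

/-- Two functors that embed compatibly, with the same image, into a family of vector spaces are
isomorphic. -/
lemma nonempty_iso_of_range_eq {𝒜 : Type*} [Category 𝒜] {F G : 𝒜 ⥤ ModuleCat.{v} K}
    {V : 𝒜 → Type v} [∀ X, AddCommGroup (V X)] [∀ X, Module K (V X)]
    (α : ∀ X, F.obj X →ₗ[K] V X) (β : ∀ X, G.obj X →ₗ[K] V X)
    (hα : ∀ X, Function.Injective (α X)) (hβ : ∀ X, Function.Injective (β X))
    (hr : ∀ X, LinearMap.range (α X) = LinearMap.range (β X))
    (hn : ∀ ⦃X Y⦄ (f : X ⟶ Y), ∃ ψ : V X → V Y, (∀ x, α Y ((F.map f).hom x) = ψ (α X x)) ∧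
      ∀ x, β Y ((G.map f).hom x) = ψ (β X x)) : Nonempty (F ≅ G) := by
  let e : ∀ X, F.obj X ≃ₗ[K] G.obj X := fun X =>
    (LinearEquiv.ofInjective (α X) (hα X)).trans ((LinearEquiv.ofEq _ _ (hr X)).trans
      (LinearEquiv.ofInjective (β X) (hβ X)).symm)
  have he : ∀ X x, β X (e X x) = α X x := fun X x =>
    congrArg Subtype.val ((LinearEquiv.ofInjective (β X) (hβ X)).apply_symm_apply
      (LinearEquiv.ofEq _ _ (hr X) (LinearEquiv.ofInjective (α X) (hα X) x)))
  refine ⟨NatIso.ofComponents (fun X => (e X).toModuleIso) fun {X Y} f =>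
    ModuleCat.hom_ext (LinearMap.ext fun x => hβ Y ?_)⟩
  obtain ⟨ψ, h₁, h₂⟩ := hn f
  calc β Y (e Y ((F.map f).hom x)) = ψ (α X x) := by rw [he, h₁]
    _ = β Y ((G.map f).hom (e X x)) := by rw [h₂, he]

variable {𝒜 : Type u} [Category.{v} 𝒜] [Abelian 𝒜] (G : 𝒜 ⥤ ModuleCat.{v} K) [G.Additive]

/-- A projective resolution `P` of `X` together with the syzygy `Ω = coker(P_{k+2} ⟶ P_{k+1})`, which
maps to `P_k`. -/
structure SyzygyData (X : 𝒜) (k : ℕ) where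
  /-- a projective resolution -/
  res : ProjectiveResolution X
  /-- the syzygy -/
  syz : 𝒜
  /-- the projection onto the syzygy -/
  p : res.complex.X (k + 1) ⟶ syz
  /-- the map from the syzygy to the next term of the resolution -/
  ω : syz ⟶ res.complex.X k
  d_p : res.complex.d (k + 2) (k + 1) ≫ p = 0
  exact : (ShortComplex.mk _ _ d_p).Exact
  epi : Epi p
  p_ω : p ≫ ω = res.complex.d (k + 1) k

variable {X : 𝒜} {k : ℕ} (S : SyzygyData X k)

/-- The complex `G(P)`. -/
abbrev SyzygyData.mapComplex : ChainComplex (ModuleCat.{v} K) ℕ :=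
  (G.mapHomologicalComplex _).obj S.res.complex

lemma SyzygyData.map_d_p :
    (S.mapComplex G).d (k + 2) (k + 1) ≫ G.map S.p = 0 := by
  refine (G.map_comp _ _).symm.trans ?_
  rw [S.d_p, G.map_zero]
  rfl

/-- The map from the homology of `G(P)` in degree `k + 1` to `G(Ω)`. -/
def SyzygyData.homologyMap : (S.mapComplex G).homology (k + 1) ⟶ G.obj S.syz :=
  (S.mapComplex G).homologyι (k + 1) ≫
    (S.mapComplex G).descOpcycles (G.map S.p) (k + 2) (by simp) (S.map_d_p G)

lemma SyzygyData.π_homologyMap :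
    (S.mapComplex G).homologyπ (k + 1) ≫ S.homologyMap G =
      (S.mapComplex G).iCycles (k + 1) ≫ G.map S.p := by
  rw [SyzygyData.homologyMap, HomologicalComplex.homology_π_ι_assoc]
  exact congrArg (fun t => (S.mapComplex G).iCycles (k + 1) ≫ t)
    (HomologicalComplex.p_descOpcycles _ _ _ _ _)

lemma SyzygyData.homologyπ_surjective :
    Function.Surjective ((S.mapComplex G).homologyπ (k + 1)).hom :=
  (ModuleCat.epi_iff_surjective _).1 inferInstance

lemma SyzygyData.homologyMap_π (z : (S.mapComplex G).cycles (k + 1)) :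
    (S.homologyMap G).hom (((S.mapComplex G).homologyπ (k + 1)).hom z) =
      (G.map S.p).hom (((S.mapComplex G).iCycles (k + 1)).hom z) :=
  congrArg (fun t => t.hom z) (S.π_homologyMap G)

lemma SyzygyData.map_exact [PreservesFiniteColimits G] :
    (∀ x : G.obj (S.res.complex.X (k + 1)), (G.map S.p).hom x = 0 →
      ∃ y : G.obj (S.res.complex.X (k + 2)),
        (G.map (S.res.complex.d (k + 2) (k + 1))).hom y = x) ∧
    Function.Surjective (G.map S.p).hom := by
  have := S.epi
  have h := S.exact.map_of_epi_of_preservesCokernel G inferInstance inferInstance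
  rw [ShortComplex.moduleCat_exact_iff] at h
  exact ⟨h, (ModuleCat.epi_iff_surjective _).1 inferInstance⟩

lemma SyzygyData.homologyMap_injective [PreservesFiniteColimits G] :
    Function.Injective (S.homologyMap G).hom := by
  rw [injective_iff_map_eq_zero]
  intro z hz
  obtain ⟨z, rfl⟩ := S.homologyπ_surjective G z
  rw [S.homologyMap_π G] at hz
  obtain ⟨y, hy⟩ := (S.map_exact G).1 _ hz
  have hi : Function.Injective ((S.mapComplex G).iCycles (k + 1)).hom :=
    (ModuleCat.mono_iff_injective _).1 inferInstance
  have hz' : ((S.mapComplex G).toCycles (k + 2) (k + 1)).hom y = z := by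
    apply hi
    refine Eq.trans ?_ hy
    exact congrArg (fun t => t.hom y) ((S.mapComplex G).toCycles_i (k + 2) (k + 1))
  rw [← hz']
  exact congrArg (fun t => t.hom y) ((S.mapComplex G).toCycles_comp_homologyπ (k + 2) (k + 1))

/-- For `G` right exact, the homology of `G(P)` in degree `k + 1` is the kernel of
`G(Ω) ⟶ G(P_k)`. -/
lemma SyzygyData.mem_range_homologyMap [PreservesFiniteColimits G] (w : G.obj S.syz) :
    w ∈ LinearMap.range (S.homologyMap G).hom ↔ (G.map S.ω).hom w = 0 := by
  have hω : ∀ x, (G.map S.ω).hom ((G.map S.p).hom x) =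
      ((S.mapComplex G).d (k + 1) k).hom x := fun x => by
    refine congrArg (fun t => t.hom x) ((G.map_comp S.p S.ω).symm.trans ?_)
    rw [S.p_ω]
    rfl
  constructor
  · rintro ⟨z, rfl⟩
    obtain ⟨z, rfl⟩ := S.homologyπ_surjective G z
    rw [S.homologyMap_π G]
    refine (hω _).trans ?_
    exact congrArg (fun t => t.hom z) ((S.mapComplex G).iCycles_d (k + 1) k)
  · intro hw
    obtain ⟨x, rfl⟩ := (S.map_exact G).2 w
    rw [hω] at hw
    have hex := ShortComplex.exact_of_f_is_kernel
      (ShortComplex.mk _ _ ((S.mapComplex G).iCycles_d (k + 1) k))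
      ((S.mapComplex G).cyclesIsKernel (k + 1) k (by simp))
    rw [ShortComplex.moduleCat_exact_iff] at hex
    obtain ⟨z, rfl⟩ := hex x hw
    exact ⟨_, S.homologyMap_π G z⟩

lemma SyzygyData.homologyMap_naturality {X' : 𝒜} (S' : SyzygyData X' k)
    (φ : S.res.complex ⟶ S'.res.complex) (ψ : S.syz ⟶ S'.syz)
    (h : S.p ≫ ψ = φ.f (k + 1) ≫ S'.p) :
    (HomologicalComplex.homologyMap ((G.mapHomologicalComplex _).map φ) (k + 1)) ≫
      S'.homologyMap G = S.homologyMap G ≫ G.map ψ := by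
  rw [← cancel_epi ((S.mapComplex G).homologyπ (k + 1)),
    HomologicalComplex.homologyπ_naturality_assoc, S'.π_homologyMap G]
  refine ((Category.assoc _ _ _).symm.trans (congrArg (fun t => t ≫ G.map S'.p)
    (HomologicalComplex.cyclesMap_i ((G.mapHomologicalComplex _).map φ) (k + 1)))).trans ?_
  refine (Category.assoc _ _ _).trans ?_
  refine Eq.trans ?_ (((congrArg (fun t => t ≫ G.map ψ) (S.π_homologyMap G)).symm.trans
    (Category.assoc _ _ _)))
  refine Eq.trans ?_ (Category.assoc _ _ _).symm
  refine congrArg (fun t => (S.mapComplex G).iCycles (k + 1) ≫ t) ?_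
  exact (G.map_comp _ _).symm.trans ((congrArg G.map h.symm).trans (G.map_comp _ _))

/-- A criterion for a functor `H` to be the left derived functor of a right exact functor `G`: it
should embed into `G(Ω)` with image the kernel of `G(Ω) ⟶ G(P_k)`, compatibly with some lifting of
each morphism to resolutions and syzygies. -/
lemma nonempty_iso_leftDerived [HasProjectiveResolutions 𝒜] [PreservesFiniteColimits G]
    {H : 𝒜 ⥤ ModuleCat.{v} K} (S : ∀ X : 𝒜, SyzygyData X k)
    (ε : ∀ X, H.obj X →ₗ[K] G.obj (S X).syz) (hε : ∀ X, Function.Injective (ε X))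
    (hr : ∀ X w, w ∈ LinearMap.range (ε X) ↔ (G.map (S X).ω).hom w = 0)
    (hn : ∀ ⦃X Y : 𝒜⦄ (f : X ⟶ Y), ∃ (φ : (S X).res.complex ⟶ (S Y).res.complex)
      (ψ : (S X).syz ⟶ (S Y).syz), φ.f 0 ≫ (S Y).res.π.f 0 = (S X).res.π.f 0 ≫ f ∧
        (S X).p ≫ ψ = φ.f (k + 1) ≫ (S Y).p ∧
        ∀ x, ε Y ((H.map f).hom x) = (G.map ψ).hom (ε X x)) :
    Nonempty (H ≅ G.leftDerived (k + 1)) := by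
  refine nonempty_iso_of_range_eq ε
    (fun X => (((S X).res.isoLeftDerivedObj G (k + 1)).hom ≫ (S X).homologyMap G).hom) hε
    (fun X => ?_) (fun X => ?_) (fun X Y f => ?_)
  · have h₁ := ConcreteCategory.bijective_of_isIso ((S X).res.isoLeftDerivedObj G (k + 1)).hom
    exact ((S X).homologyMap_injective G).comp h₁.1
  · have h₁ := ConcreteCategory.bijective_of_isIso ((S X).res.isoLeftDerivedObj G (k + 1)).hom
    ext w
    rw [hr, ← (S X).mem_range_homologyMap G]
    constructor
    · rintro ⟨z, rfl⟩
      obtain ⟨y, rfl⟩ := h₁.2 z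
      exact ⟨y, rfl⟩
    · rintro ⟨y, rfl⟩
      exact ⟨_, rfl⟩
  · obtain ⟨φ, ψ, h₀, hp, hψ⟩ := hn f
    refine ⟨_, hψ, fun x => ?_⟩
    have : (G.leftDerived (k + 1)).map f ≫
        ((S Y).res.isoLeftDerivedObj G (k + 1)).hom ≫ (S Y).homologyMap G =
        (((S X).res.isoLeftDerivedObj G (k + 1)).hom ≫ (S X).homologyMap G) ≫ G.map ψ := by
      have e := ProjectiveResolution.isoLeftDerivedObj_hom_naturality f (S X).res (S Y).res φ h₀ G
        (k + 1)
      refine ((Category.assoc _ _ _).symm.trans (congrArg (fun t => t ≫ _) e)).trans ?_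
      refine (Category.assoc _ _ _).trans (Eq.trans ?_ (Category.assoc _ _ _).symm)
      exact congrArg (fun t => ((S X).res.isoLeftDerivedObj G (k + 1)).hom ≫ t)
        ((S X).homologyMap_naturality G (S Y) φ ψ hp)
    exact congrArg (fun t => t.hom x) this

end Derived

/-! ### Presentations of the functors `Extⁿ` -/

section ExtPresentation

variable {K : Type v} [Field K] {C : Type u} [Category.{v} C] [Abelian C]

/-- The syzygy of a projective resolution, given by the opcycles. -/
def syzygyData {X : C} (R : ProjectiveResolution X) (k : ℕ) : SyzygyData X k where
  res := R
  syz := R.complex.opcycles (k + 1)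
  p := R.complex.pOpcycles (k + 1)
  ω := R.complex.fromOpcycles (k + 1) k
  d_p := by simp
  exact := ShortComplex.exact_of_g_is_cokernel _
    (R.complex.opcyclesIsCokernel (k + 2) (k + 1) (by simp))
  epi := inferInstance
  p_ω := by simp

/-- The chain complex in the opposite category given by a cochain complex. -/
def opComplex (I : CochainComplex C ℕ) : ChainComplex Cᵒᵖ ℕ where
  X i := op (I.X i)
  d i j := (I.d j i).op
  shape i j h := by rw [I.shape j i h, op_zero]
  d_comp_d' i j l _ _ := by rw [← op_comp, I.d_comp_d, op_zero]

/-- An injective resolution of `Y` is a projective resolution of `op Y` in the opposite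
category. -/
def opResolution {Y : C} (I : InjectiveResolution Y) : ProjectiveResolution (op Y) where
  complex := opComplex I.cocomplex
  projective n := inferInstanceAs (Projective (op (I.cocomplex.X n)))
  π := (ChainComplex.toSingle₀Equiv (opComplex I.cocomplex) (op Y)).symm ⟨(I.ι.f 0).op, by
    change (I.cocomplex.d 0 1).op ≫ (I.ι.f 0).op = 0
    rw [← op_comp, I.ι_f_zero_comp_complex_d, op_zero]⟩
  quasiIso := ⟨fun n => by
    cases n with
    | zero =>
      rw [ChainComplex.quasiIsoAt₀_iff, ShortComplex.quasiIso_iff_of_zeros']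
      · refine (ShortComplex.exact_and_epi_g_iff_of_iso ?_).2
          ⟨I.exact₀.op, inferInstanceAs (Epi (I.ι.f 0).op)⟩
        exact ShortComplex.isoMk (Iso.refl _) (Iso.refl _) (Iso.refl _)
          ((Category.id_comp _).trans (Category.comp_id _).symm) (by
            refine (Category.id_comp _).trans (Eq.trans ?_ (Category.comp_id _).symm)
            exact (ChainComplex.toSingle₀Equiv_symm_apply_f_zero
              (C := opComplex I.cocomplex) (X := op Y) _ _).symm)
      · exact (opComplex I.cocomplex).shape _ _ (by simp)
      · rfl
      · rfl
    | succ n =>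
      rw [quasiIsoAt_iff_exactAt']
      · rw [HomologicalComplex.exactAt_iff' _ (n + 2) (n + 1) n (by simp) (by simp)]
        exact (I.exact_succ _).op
      · apply ChainComplex.exactAt_succ_single_obj⟩

lemma opResolution_π_f_zero {Y : C} (I : InjectiveResolution Y) :
    (opResolution I).π.f 0 = (I.ι.f 0).op :=
  ChainComplex.toSingle₀Equiv_symm_apply_f_zero (C := opComplex I.cocomplex) (X := op Y) _ _

/-- The syzygy in the opposite category given by an injective resolution. -/
def cosyzygyData {Y : C} (I : InjectiveResolution Y) (k : ℕ) : SyzygyData (op Y) k where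
  res := opResolution I
  syz := op (I.cocomplex.cycles (k + 1))
  p := (I.cocomplex.iCycles (k + 1)).op
  ω := (I.cocomplex.toCycles k (k + 1)).op
  d_p := by
    change (I.cocomplex.d (k + 1) (k + 2)).op ≫ (I.cocomplex.iCycles (k + 1)).op = 0
    rw [← op_comp, HomologicalComplex.iCycles_d, op_zero]
  exact := (ShortComplex.exact_of_f_is_kernel
    (ShortComplex.mk _ _ (I.cocomplex.iCycles_d (k + 1) (k + 2)))
    (I.cocomplex.cyclesIsKernel (k + 1) (k + 2) (by simp))).op
  epi := inferInstanceAs (Epi (I.cocomplex.iCycles (k + 1)).op)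
  p_ω := congrArg Quiver.Hom.op (I.cocomplex.toCycles_i k (k + 1))

variable [Linear K C] [HasExt.{v} C]

/-- The class in `Ext^{k+1}(X, Ω)` of the projection onto the syzygy. -/
def SyzygyData.extClass {X : C} {k : ℕ} (S : SyzygyData X k) : Abelian.Ext.{v} X S.syz (k + 1) :=
  S.res.extMk S.p (k + 2) rfl S.d_p

variable (K) in
/-- The functor `Ext^{k+1}(X, -)` is the cokernel of `C(P_k, -) ⟶ C(Ω, -)`. -/
lemma SyzygyData.isPresentation {X : C} {k : ℕ} (S : SyzygyData X k) :
    IsPresentation ((extBimoduleOfHasExt K C (k + 1)).left.obj (op X)) S.ω S.extClass := by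
  have := S.epi
  have hmap : ∀ {Y : C} (g : S.syz ⟶ Y),
      (((extBimoduleOfHasExt K C (k + 1)).left.obj (op X)).obj.map g).hom S.extClass =
        S.res.extMk (S.p ≫ g) (k + 2) rfl (by rw [← Category.assoc, S.d_p, zero_comp]) :=
    fun g => S.res.extMk_comp_mk₀ S.p (k + 2) rfl S.d_p g
  constructor
  · intro Y (α : Abelian.Ext.{v} X Y (k + 1))
    obtain ⟨f, hf, rfl⟩ := S.res.extMk_surjective α (k + 2) rfl
    refine ⟨S.exact.desc f hf, (hmap _).trans ?_⟩
    congr 1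
    exact S.exact.g_desc f hf
  · intro Y g
    rw [hmap]
    refine (S.res.extMk_eq_zero_iff _ _ _ _ k rfl).trans (exists_congr fun h => ?_)
    rw [← S.p_ω, Category.assoc, cancel_epi, eq_comm]

lemma SyzygyData.extClass_naturality {X X' : C} {k : ℕ} (S : SyzygyData X k)
    (S' : SyzygyData X' k) (f : X ⟶ X') (φ : S.res.Hom S'.res f) (ψ : S.syz ⟶ S'.syz)
    (h : S.p ≫ ψ = φ.hom.f (k + 1) ≫ S'.p) :
    (Abelian.Ext.mk₀ f).comp S'.extClass (zero_add _) =
      S.extClass.comp (Abelian.Ext.mk₀ ψ) (add_zero _) := by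
  rw [extClass, extClass, ProjectiveResolution.mk₀_comp_extMk _ _ _ _ φ,
    ProjectiveResolution.extMk_comp_mk₀]
  congr 1
  exact h.symm

/-- The class in `Ext^{k+1}(Z, Y)` of the inclusion of the cosyzygy `Z`. -/
def coextClass {Y : C} (I : InjectiveResolution Y) (k : ℕ) :
    Abelian.Ext.{v} (I.cocomplex.cycles (k + 1)) Y (k + 1) :=
  I.extMk (I.cocomplex.iCycles (k + 1)) (k + 2) rfl (by simp)

variable (K) in
/-- The functor `Ext^{k+1}(-, Y)` is the cokernel of `C(-, I^k) ⟶ C(-, Z)`. -/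
lemma isPresentation_coextClass {Y : C} (I : InjectiveResolution Y) (k : ℕ) :
    IsPresentation ((extBimoduleOfHasExt K C (k + 1)).right.obj Y) (cosyzygyData I k).ω
      (coextClass I k) := by
  have hmap : ∀ {X : Cᵒᵖ} (g : op (I.cocomplex.cycles (k + 1)) ⟶ X),
      (((extBimoduleOfHasExt K C (k + 1)).right.obj Y).obj.map g).hom (coextClass I k) =
        I.extMk (g.unop ≫ I.cocomplex.iCycles (k + 1)) (k + 2) rfl (by simp) :=
    fun g => I.mk₀_comp_extMk _ (k + 2) rfl _ g.unop
  constructor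
  · intro X (α : Abelian.Ext.{v} X.unop Y (k + 1))
    obtain ⟨f, hf, rfl⟩ := I.extMk_surjective α (k + 2) rfl
    refine ⟨(I.cocomplex.liftCycles f (k + 2) (by simp) hf).op, (hmap _).trans ?_⟩
    congr 1
    exact I.cocomplex.liftCycles_i f (k + 2) (by simp) hf
  · intro X g
    refine (Eq.congr_left (hmap g)).trans ?_
    refine (I.extMk_eq_zero_iff _ _ _ _ k rfl).trans ⟨?_, ?_⟩
    · rintro ⟨h, hh⟩
      refine ⟨h.op, Quiver.Hom.unop_inj ?_⟩
      refine (cancel_mono (I.cocomplex.iCycles (k + 1))).1 (hh.symm.trans ?_)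
      exact (congrArg (fun t => h ≫ t) (I.cocomplex.toCycles_i k (k + 1)).symm).trans
        (Category.assoc _ _ _).symm
    · rintro ⟨h, rfl⟩
      refine ⟨h.unop, ?_⟩
      exact (congrArg (fun t => h.unop ≫ t) (I.cocomplex.toCycles_i k (k + 1)).symm).trans
        (Category.assoc _ _ _).symm

lemma coextClass_naturality {Y Y' : C} (I : InjectiveResolution Y) (I' : InjectiveResolution Y')
    (k : ℕ) (f : Y ⟶ Y') (φ : I.Hom I' f) :
    (coextClass I k).comp (Abelian.Ext.mk₀ f) (add_zero _) =
      (Abelian.Ext.mk₀ (HomologicalComplex.cyclesMap φ.hom (k + 1))).comp (coextClass I' k)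
        (zero_add _) := by
  rw [coextClass, coextClass, InjectiveResolution.extMk_comp_mk₀ _ _ _ _ φ,
    InjectiveResolution.mk₀_comp_extMk]
  congr 1
  simp

end ExtPresentation

/-! ### Duals of tensor products with `Extⁿ` as derived functors -/

section DualTensorExt

variable {K : Type v} [Field K]

/-- A presentation of `M_X` seen as a module over the double opposite category. -/
lemma IsPresentation.bar {T : Type u₁} [Category.{v} T] [Preadditive T] [Linear K T]
    {U : Type u₂} [Category.{v} U] [Preadditive U] [Linear K U] {M : Bimodule K T U} {X : T}
    {Y₀ Y₁ : U} {f : Y₀ ⟶ Y₁} {x : (M.left.obj (op X)).obj.obj Y₀}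
    (h : IsPresentation (M.left.obj (op X)) f x) :
    IsPresentation (M.bar.right.obj (op X)) f.op.op x where
  gen Y y := by
    obtain ⟨g, hg⟩ := h.gen Y.unop.unop y
    exact ⟨g.op.op, hg⟩
  rel Y g := by
    refine (h.rel g.unop.unop).trans ⟨?_, ?_⟩
    · rintro ⟨l, hl⟩
      exact ⟨l.op.op, Quiver.Hom.unop_inj (Quiver.Hom.unop_inj hl)⟩
    · rintro ⟨l, rfl⟩
      exact ⟨l.unop.unop, rfl⟩

variable {C : Type u} [Category.{v} C] [Abelian C] [Linear K C] [EssentiallySmall.{v} C]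
  [HasExt.{v} C] (k : ℕ)

/-- Both functors are the kernel of `D A(Z) ⟶ D A(I^k)`, for the cosyzygy `Z` of an injective
resolution `I`. -/
lemma nonempty_dual_tensor_ext_iso [EnoughInjectives C] (A : LMod K C)
    [PreservesFiniteColimits ((dual K C).obj (op A)).obj] :
    Nonempty (((dual K C).obj (op (tensorObj (extBimoduleOfHasExt K C (k + 1)) A))).obj ≅
      ((dual K C).obj (op A)).obj.leftDerived (k + 1)) := by
  let I : ∀ Y : C, InjectiveResolution Y := fun Y => InjectiveResolution.of Y
  refine nonempty_iso_leftDerived _ (fun Y => cosyzygyData (I Y.unop) k)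
    (fun Y => dualTensorMap A (Y := Y.unop) (coextClass (I Y.unop) k))
    (fun Y => dualTensorMap_injective (isPresentation_coextClass K (I Y.unop) k))
    (fun Y w => ?_) (fun Y' Y f => ?_)
  · refine (mem_range_dualTensorMap (isPresentation_coextClass K (I Y.unop) k) w).trans ?_
    exact ⟨fun h => LinearMap.ext h,
      fun h a => congrArg (fun t : Module.Dual K (A.obj.obj _) => t a) h⟩
  · let φ : (I Y.unop).Hom (I Y'.unop) f.unop :=
      { hom := InjectiveResolution.desc f.unop (I Y'.unop) (I Y.unop)
        ι_f_zero_comp_hom_f_zero :=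
          HomologicalComplex.congr_hom (InjectiveResolution.desc_commutes f.unop _ _) 0 }
    refine ⟨{ f := fun i => (φ.hom.f i).op
              comm' := fun i j _ => congrArg Quiver.Hom.op (φ.hom.comm j i).symm },
      (HomologicalComplex.cyclesMap φ.hom (k + 1)).op, ?_, ?_, ?_⟩
    · refine (congrArg (fun t => (φ.hom.f 0).op ≫ t) (opResolution_π_f_zero _)).trans
        (Eq.trans ?_ (congrArg (fun t => t ≫ f) (opResolution_π_f_zero _).symm))
      exact congrArg Quiver.Hom.op (InjectiveResolution.desc_commutes_zero f.unop _ _)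
    · exact congrArg Quiver.Hom.op (HomologicalComplex.cyclesMap_i φ.hom (k + 1))
    · intro ζ
      exact dualTensorMap_naturality (M := extBimoduleOfHasExt K C (k + 1)) (A := A)
        (X := op ((I Y.unop).cocomplex.cycles (k + 1)))
        (X' := op ((I Y'.unop).cocomplex.cycles (k + 1))) (Y := Y.unop) (Y' := Y'.unop)
        (coextClass (I Y.unop) k) (coextClass (I Y'.unop) k) f.unop
        (HomologicalComplex.cyclesMap φ.hom (k + 1)).op
        (coextClass_naturality _ _ k f.unop φ) ζ

/-- Both functors are the kernel of `D B(Ω) ⟶ D B(P_k)`, for the syzygy `Ω` of a projective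
resolution `P`. -/
lemma nonempty_dualOp_tensor_ext_iso [EnoughProjectives C] (B : LMod K Cᵒᵖ)
    [PreservesFiniteColimits ((dualOp K C).obj (op B)).obj] :
    Nonempty (((dualOp K C).obj (op (tensorObj (extBimoduleOfHasExt K C (k + 1)).bar B))).obj ≅
      ((dualOp K C).obj (op B)).obj.leftDerived (k + 1)) := by
  let S : ∀ X : C, SyzygyData X k := fun X => syzygyData (ProjectiveResolution.of X) k
  have hS : ∀ X, IsPresentation ((extBimoduleOfHasExt K C (k + 1)).bar.right.obj (op X))
    (S X).ω.op.op (S X).extClass := fun X => ((S X).isPresentation K).bar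
  refine nonempty_iso_leftDerived _ S (fun X => dualTensorMap B (X := op (op (S X).syz))
      (M := (extBimoduleOfHasExt K C (k + 1)).bar) (Y := op X) (S X).extClass)
    (fun X => dualTensorMap_injective (hS X)) (fun X w => ?_) (fun X X' f => ?_)
  · refine (mem_range_dualTensorMap (hS X) w).trans ?_
    exact ⟨fun h => LinearMap.ext h,
      fun h a => congrArg (fun t : Module.Dual K (B.obj.obj _) => t a) h⟩
  · let φ : (S X).res.Hom (S X').res f :=
      { hom := ProjectiveResolution.lift f _ _
        hom_f_zero_comp_π_f_zero :=
          HomologicalComplex.congr_hom (ProjectiveResolution.lift_commutes f _ _) 0 }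
    have hψ : (S X).p ≫ HomologicalComplex.opcyclesMap φ.hom (k + 1) =
        φ.hom.f (k + 1) ≫ (S X').p := HomologicalComplex.p_opcyclesMap φ.hom (k + 1)
    refine ⟨φ.hom, HomologicalComplex.opcyclesMap φ.hom (k + 1),
      ProjectiveResolution.lift_commutes_zero f _ _, hψ, fun ζ => ?_⟩
    exact dualTensorMap_naturality (M := (extBimoduleOfHasExt K C (k + 1)).bar) (A := B)
      (X := op (op (S X').syz)) (X' := op (op (S X).syz)) (S X').extClass (S X).extClass f.op
      (HomologicalComplex.opcyclesMap φ.hom (k + 1)).op.op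
      ((S X).extClass_naturality (S X') f φ _ hψ) ζ

end DualTensorExt

/-! ### The triangular matrix category of `Extⁿ` -/

section TriMatExt

variable (K : Type v) [Field K] {C : Type u} [Category.{v} C] [Abelian C] [Linear K C]
  [EssentiallySmall.{v} C] [EnoughProjectives C]

lemma isDualizing_triMat_ext (hC : IsDualizing K C) (k : ℕ) :
    IsDualizing K (TriMat (extBimodule K C (k + 1))) := by
  have : HasExt.{v} C := hasExt_of_enoughProjectives.{v} C
  have : HasFiniteBiproducts C := Abelian.hasFiniteBiproducts
  have : EnoughInjectives C := enoughInjectives_of_dualsPreserveFP hC.dualsPreserveFP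
  exact isDualizing_triMat hC hC _
    (fun X => ((syzygyData (ProjectiveResolution.of X) k).isPresentation K).isFP)
    (fun Y => (isPresentation_coextClass K (InjectiveResolution.of Y) k).isFP)

lemma nonempty_dual_leftAdjoint_iso [EnoughInjectives C] (k : ℕ)
    [(extBimodule K C (k + 1)).G.IsRightAdjoint] (A : LMod K C)
    [PreservesFiniteColimits ((dual K C).obj (op A)).obj] :
    Nonempty (((dual K C).obj (op ((extBimodule K C (k + 1)).G.leftAdjoint.obj A))).obj ≅
      ((dual K C).obj (op A)).obj.leftDerived (k + 1)) := by
  have : HasExt.{v} C := hasExt_of_enoughProjectives.{v} C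
  obtain ⟨e⟩ := nonempty_dual_tensor_ext_iso k A
  exact ⟨(linearProp K Cᵒᵖ).ι.mapIso ((dual K C).mapIso
    (leftAdjointObjIso (extBimodule K C (k + 1)) A).symm.op) ≪≫ e⟩

lemma nonempty_dualOp_leftAdjoint_iso (k : ℕ)
    [(extBimodule K C (k + 1)).bar.G.IsRightAdjoint] (B : LMod K Cᵒᵖ)
    [PreservesFiniteColimits ((dualOp K C).obj (op B)).obj] :
    Nonempty (((dualOp K C).obj (op ((extBimodule K C (k + 1)).bar.G.leftAdjoint.obj B))).obj ≅
      ((dualOp K C).obj (op B)).obj.leftDerived (k + 1)) := by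
  have : HasExt.{v} C := hasExt_of_enoughProjectives.{v} C
  obtain ⟨e⟩ := nonempty_dualOp_tensor_ext_iso k B
  exact ⟨(linearProp K C).ι.mapIso ((dualOp K C).mapIso
    (leftAdjointObjIso (extBimodule K C (k + 1)).bar B).symm.op) ≪≫ e⟩

variable (C) in
/-- The degree is written as `k + 1` in order to have the term `P_k` of a resolution at hand. -/
lemma isDualizing_and_leftDerived_ext (hC : IsDualizing K C) (k : ℕ) :
    IsDualizing K (TriMat (extBimodule K C (k + 1))) ∧
      (∃ _ : (extBimodule K C (k + 1)).bar.G.IsRightAdjoint,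
        ∀ B : LMod K Cᵒᵖ, IsFP ((dualOp K C).obj (op B)) →
          PreservesFiniteColimits ((dualOp K C).obj (op B)).obj →
          Nonempty (((dualOp K C).obj
            (op ((extBimodule K C (k + 1)).bar.G.leftAdjoint.obj B))).obj ≅
            ((dualOp K C).obj (op B)).obj.leftDerived (k + 1))) ∧
      (∃ (_ : (extBimodule K C (k + 1)).G.IsRightAdjoint) (_ : EnoughInjectives C),
        ∀ A : LMod K C, IsFP ((dual K C).obj (op A)) →
          PreservesFiniteColimits ((dual K C).obj (op A)).obj →
          Nonempty (((dual K C).obj (op ((extBimodule K C (k + 1)).G.leftAdjoint.obj A))).obj ≅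
            ((dual K C).obj (op A)).obj.leftDerived (k + 1))) := by
  have : HasFiniteBiproducts C := Abelian.hasFiniteBiproducts
  have : EnoughInjectives C := enoughInjectives_of_dualsPreserveFP hC.dualsPreserveFP
  have h₁ := isRightAdjoint_G (extBimodule K C (k + 1)).bar
  have h₂ := isRightAdjoint_G (extBimodule K C (k + 1))
  exact ⟨isDualizing_triMat_ext K hC k,
    ⟨h₁, fun B _ _ => nonempty_dualOp_leftAdjoint_iso K k B⟩,
    ⟨h₂, this, fun A _ _ => nonempty_dual_leftAdjoint_iso K k A⟩⟩

end TriMatExt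

end

end TriangularCategory

theorem mainTheorem4 (K : Type v) [Field K] :
    -- Part (a)
    (∀ (C : Type u) [Category.{v} C] [Preadditive C] [Linear K C],
      IsDualizing K C → IsDualizing K (TriMat (homBimodule K C))) ∧
    -- Part (b)
    (∀ (C : Type u) [Category.{v} C] [Abelian C] [Linear K C] [EssentiallySmall.{v} C]
      [EnoughProjectives C],
      IsDualizing K C → ∀ n : ℕ, 1 ≤ n →
      (∀ X : C, IsFP ((extBimodule K C n).right.obj X)) →
      (∀ X : C, IsFP ((extBimodule K C n).left.obj (op X))) →
      IsDualizing K (TriMat (extBimodule K C n)) ∧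
      (∃ _ : (extBimodule K C n).bar.G.IsRightAdjoint,
        ∀ B : LMod K Cᵒᵖ, IsFP ((dualOp K C).obj (op B)) →
          PreservesFiniteColimits ((dualOp K C).obj (op B)).obj →
          Nonempty (((dualOp K C).obj (op ((extBimodule K C n).bar.G.leftAdjoint.obj B))).obj ≅
            ((dualOp K C).obj (op B)).obj.leftDerived n)) ∧
      (∃ (_ : (extBimodule K C n).G.IsRightAdjoint) (_ : EnoughInjectives C),
        ∀ A : LMod K C, IsFP ((dual K C).obj (op A)) →
          PreservesFiniteColimits ((dual K C).obj (op A)).obj →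
          Nonempty (((dual K C).obj (op ((extBimodule K C n).G.leftAdjoint.obj A))).obj ≅
            ((dual K C).obj (op A)).obj.leftDerived n))) ∧
    -- Part (c)
    (∀ (C : Type u) [Category.{v} C] [Abelian C] [Linear K C] [EssentiallySmall.{v} C]
      [EnoughProjectives C],
      IsDualizing K C →
      IsDualizing K (TriMat (extBimodule K C 1)) ∧
      (∃ _ : (extBimodule K C 1).bar.G.IsRightAdjoint,
        ∀ B : LMod K Cᵒᵖ, IsFP ((dualOp K C).obj (op B)) →
          PreservesFiniteColimits ((dualOp K C).obj (op B)).obj →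
          Nonempty (((dualOp K C).obj (op ((extBimodule K C 1).bar.G.leftAdjoint.obj B))).obj ≅
            ((dualOp K C).obj (op B)).obj.leftDerived 1)) ∧
      (∃ (_ : (extBimodule K C 1).G.IsRightAdjoint) (_ : EnoughInjectives C),
        ∀ A : LMod K C, IsFP ((dual K C).obj (op A)) →
          PreservesFiniteColimits ((dual K C).obj (op A)).obj →
          Nonempty (((dual K C).obj (op ((extBimodule K C 1).G.leftAdjoint.obj A))).obj ≅
            ((dual K C).obj (op A)).obj.leftDerived 1))) := by
  refine ⟨fun C _ _ _ hC => isDualizing_triMat_hom hC, fun C _ _ _ _ _ hC n hn _ _ => ?_,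
    fun C _ _ _ _ _ hC => isDualizing_and_leftDerived_ext K C hC 0⟩
  obtain ⟨k, rfl⟩ := Nat.exists_eq_add_of_le' hn
  exact isDualizing_and_leftDerived_ext K C hC k
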